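/- Let $N\ge 1$ and consider the star graph with $N$ edges $(0,l_i)$, $l_i>0$, whose endpoints $x=0$ are all identified with the central vertex. Let $T>0$, $D_i>0$ and $Q_i=(0,l_i)\times(0,T)$ for $i=1,\dots,N$, and put $\underline D=\min_i D_i$, $\bar D=\max_i D_i$. Let $$\mathbb L^2=\prod_{i=1}^N L^2(0,l_i),\quad \|\rho\|_{\mathbb L^2}^2=\sum_i\|\rho_i\|_{L^2(0,l_i)}^2,\qquad \mathbb L^\infty=\prod_{i=1}^N L^\infty(Q_i),\quad \|u\|_{\mathbb L^\infty}=\sum_i\|u_i\|_{L^\infty(Q_i)},$$ $$\mathbb V=\Big\{\varphi\in\prod_{i=1}^N H^1(0,l_i):\ \varphi_i(0)=\varphi_j(0),\ \varphi_i(l_i)=0\ \text{ for all } i,j\Big\},\qquad \|\varphi\|_{\mathbb V}^2=\sum_i\|\varphi_i\|_{H^1(0,l_i)}^2,$$ let $\mathbb V\hookrightarrow\mathbb L^2\hookrightarrow\mathbb V^\star$, with $\mathbb L^2$ identified with its dual, and $$\mathbb W(0,T)=\{\rho\in L^2(0,T;\mathbb V):\ \rho_t\in L^2(0,T;\mathbb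 V^\star)\},\qquad \|\rho\|_{\mathbb W(0,T)}^2=\|\rho\|_{L^2(0,T;\mathbb V)}^2+\|\rho_t\|_{L^2(0,T;\mathbb V^\star)}^2 .$$ Given $u\in\mathbb L^\infty$ and $\rho^0\in\mathbb L^2$, a weak solution of the Fokker–Planck system $$\begin{cases}\partial_t\rho_i-D_i\,\partial_x^2\rho_i-\partial_x(u_i\rho_i)=0 & \text{in } Q_i,\\ \rho_i(x,0)=\rho_i^0(x), & x\in(0,l_i),\\ \sum_{i=1}^N\big[D_i\,\partial_x\rho_i(0,t)+u_i(0,t)\rho_i(0,t)\big]=0, & t\in(0,T),\\ \rho_i(0,t)=\rho_j(0,t),\ i\ne j,\qquad \rho_i(l_i,t)=0, & t\in(0,T),\end{cases}$$ is a function $\rho\in\mathbb W(0,T)$ whose representative in $\mathcal C([0,T];\mathbb L^2)$ satisfies $\rho(\cdot,0)=\rho^0$ and such that, for every $\varphi\in\mathbb V$, $$\frac{d}{dt}\sum_{i=1}^N(\rho_i(\cdot),\varphi_i)_{L^2(0,l_i)}+\sum_{i=1}^N\int_0^{l_i}\big(D_i\,\partial_x\rho_i+u_i\rho_i\big)\,\partial_x\varphi_i\,dx=0\quad\text{in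 }\mathcal D'(0,T).$$ Theorem. For every $u\in\mathbb L^\infty$ and $\rho^0\in\mathbb L^2$ there exists a unique weak solution $\rho\in\mathbb W(0,T)$. In addition, there is a constant $C>0$, depending only on $T$, $\underline D$, $\bar D$ and (continuously) on $\|u\|_{\mathbb L^\infty}$, such that $$\|\rho\|_{\mathcal C([0,T];\mathbb L^2)}+\|\rho\|_{L^2(0,T;\mathbb V)}\le C\,\|\rho^0\|_{\mathbb L^2},\qquad \|\rho\|_{\mathbb W(0,T)}\le C\,\|\rho^0\|_{\mathbb L^2}.$$ -/

import Mathlib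

open MeasureTheory Set
open scoped ENNReal Distributions

noncomputable section

namespace StarGraph

/-! ### Weak derivatives on a bounded open interval -/

/-- The open interval `(a, b)` as an open set. -/
def interval (a b : ℝ) : TopologicalSpace.Opens ℝ := ⟨Ioo a b, isOpen_Ioo⟩

/-- Lebesgue measure on the interval `(a, b)`. -/
abbrev vol (a b : ℝ) : Measure ℝ := volume.restrict (Ioo a b)

/-- `g` is the weak (distributional) derivative of `f` on `(a, b)`:
`∫ ψ' f = - ∫ ψ g` for every real test function `ψ ∈ C_c^∞(a, b)`. -/
def IsWeakDeriv {E : Type*} [NormedAddCommGroup E] [NormedSpace ℝ E] (a b : ℝ)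
    (f g : ℝ → E) : Prop :=
  ∀ ψ : 𝓓(interval a b, ℝ),
    ∫ t, deriv ψ t • f t ∂(vol a b) = - ∫ t, ψ t • g t ∂(vol a b)

section WeakDeriv

variable {E : Type*} [NormedAddCommGroup E] [NormedSpace ℝ E] {a b : ℝ}

lemma integrable_testFunction_smul (ψ : 𝓓(interval a b, ℝ)) {f : ℝ → E}
    (hf : MemLp f 2 (vol a b)) : Integrable (fun t => ψ t • f t) (vol a b) := by
  obtain ⟨C, hC⟩ := ψ.hasCompactSupport.exists_bound_of_continuous ψ.contDiff.continuous
  exact (hf.integrable one_le_two).bdd_smul C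
    ψ.contDiff.continuous.aestronglyMeasurable (Filter.Eventually.of_forall hC)

lemma integrable_deriv_testFunction_smul (ψ : 𝓓(interval a b, ℝ)) {f : ℝ → E}
    (hf : MemLp f 2 (vol a b)) : Integrable (fun t => deriv ψ t • f t) (vol a b) := by
  have hc : Continuous (deriv ψ) := ψ.contDiff.continuous_deriv (by simp)
  obtain ⟨C, hC⟩ := ψ.hasCompactSupport.deriv.exists_bound_of_continuous hc
  exact (hf.integrable one_le_two).bdd_smul C
    hc.aestronglyMeasurable (Filter.Eventually.of_forall hC)

lemma IsWeakDeriv.congr {f g f' g' : ℝ → E} (h : IsWeakDeriv a b f g)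
    (hf : f' =ᵐ[vol a b] f) (hg : g' =ᵐ[vol a b] g) : IsWeakDeriv a b f' g' := by
  intro ψ
  rw [integral_congr_ae (hf.mono fun t ht => congrArg (deriv ψ t • ·) ht),
    integral_congr_ae (hg.mono fun t ht => congrArg (ψ t • ·) ht)]
  exact h ψ

lemma IsWeakDeriv.zero : IsWeakDeriv a b (0 : ℝ → E) 0 := by
  intro ψ; simp

lemma IsWeakDeriv.add {f g f' g' : ℝ → E} (h : IsWeakDeriv a b f g) (h' : IsWeakDeriv a b f' g')
    (hf : MemLp f 2 (vol a b)) (hg : MemLp g 2 (vol a b))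
    (hf' : MemLp f' 2 (vol a b)) (hg' : MemLp g' 2 (vol a b)) :
    IsWeakDeriv a b (f + f') (g + g') := by
  intro ψ
  simp only [Pi.add_apply, smul_add]
  rw [integral_add (integrable_deriv_testFunction_smul ψ hf)
      (integrable_deriv_testFunction_smul ψ hf'),
    integral_add (integrable_testFunction_smul ψ hg) (integrable_testFunction_smul ψ hg'),
    h ψ, h' ψ, neg_add]

lemma IsWeakDeriv.smul {f g : ℝ → E} (c : ℝ) (h : IsWeakDeriv a b f g) :
    IsWeakDeriv a b (c • f) (c • g) := by
  intro ψ
  simp only [Pi.smul_apply, smul_comm _ c]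
  rw [integral_smul, integral_smul, h ψ, smul_neg]

end WeakDeriv

/-! ### The evolution space of a triple `𝕍 ↪ ℍ ↪ 𝕍⋆` -/

section Evolution

variable {V H : Type} [NormedAddCommGroup V] [NormedSpace ℝ V]
  [NormedAddCommGroup H] [InnerProductSpace ℝ H]

/-- The map `𝕍 → ℍ → 𝕍⋆`, `ρ ↦ (φ ↦ (j ρ, j φ))`, induced by an embedding `j : 𝕍 → ℍ` into a
Hilbert space that is identified with its dual. The dual `𝕍⋆` carries the dual norm. -/
def toDual (j : V →L[ℝ] H) : V →L[ℝ] StrongDual ℝ V :=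
  (ContinuousLinearMap.precomp ℝ j) ∘L (innerSL ℝ) ∘L j

lemma toDual_apply (j : V →L[ℝ] H) (ρ φ : V) : toDual j ρ φ = inner ℝ (j ρ) (j φ) := rfl

/-- The Bochner space `L²(0, T; E)`. -/
abbrev L2T (T : ℝ) (E : Type) [NormedAddCommGroup E] : Type := Lp E 2 (vol 0 T)

/-- `𝕎(0, T) = {ρ ∈ L²(0, T; 𝕍) : ρ_t ∈ L²(0, T; 𝕍⋆)}`, as the space of all pairs `(ρ, ρ_t)`
where `ρ_t` is the weak derivative of `ρ` regarded as a `𝕍⋆`-valued function. Its norm is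
`(‖ρ‖²_{L²(0, T; 𝕍)} + ‖ρ_t‖²_{L²(0, T; 𝕍⋆)})^(1/2)`. -/
def EvolutionSpace (j : V →L[ℝ] H) (T : ℝ) :
    Submodule ℝ (WithLp 2 (L2T T V × L2T T (StrongDual ℝ V))) where
  carrier := {p | IsWeakDeriv 0 T (fun t => toDual j (p.fst t)) p.snd}
  zero_mem' := by
    refine IsWeakDeriv.zero.congr ?_ (Lp.coeFn_zero (StrongDual ℝ V) 2 (vol 0 T))
    filter_upwards [Lp.coeFn_zero V 2 (vol 0 T)] with t ht
    exact (congrArg (toDual j) ht).trans (map_zero _)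
  add_mem' {p q} hp hq := by
    refine (IsWeakDeriv.add hp hq ((toDual j).comp_memLp _) (Lp.memLp _)
      ((toDual j).comp_memLp _) (Lp.memLp _)).congr ?_ (Lp.coeFn_add p.snd q.snd)
    filter_upwards [Lp.coeFn_add p.fst q.fst] with t ht
    exact (congrArg (toDual j) ht).trans (map_add _ _ _)
  smul_mem' c p hp := by
    refine (IsWeakDeriv.smul c hp).congr ?_ (Lp.coeFn_smul c p.snd)
    filter_upwards [Lp.coeFn_smul c p.fst] with t ht
    exact (congrArg (toDual j) ht).trans (map_smul _ _ _)

/-- The function `ρ ∈ L²(0, T; 𝕍)` underlying an element of `𝕎(0, T)`. -/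
def EvolutionSpace.toL2T {j : V →L[ℝ] H} {T : ℝ} (ρ : EvolutionSpace j T) : L2T T V :=
  (ρ : WithLp 2 (L2T T V × L2T T (StrongDual ℝ V))).fst

/-- `r ∈ C([0, T]; ℍ)` is the continuous representative of `ρ ∈ 𝕎(0, T)`. -/
def IsTimeContRep {j : V →L[ℝ] H} {T : ℝ} (ρ : EvolutionSpace j T)
    (r : C(Icc (0 : ℝ) T, H)) : Prop :=
  ∀ᵐ t ∂(vol 0 T), ∀ ht : t ∈ Icc (0 : ℝ) T, r ⟨t, ht⟩ = j (EvolutionSpace.toL2T ρ t)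

end Evolution

/-! ### Function spaces on the star graph

The star graph has `N` edges; the edge `i` is the interval `(0, l i)`, the endpoint `0` of every edge
is the central vertex and `l i` is the outer vertex of the edge `i`. -/

/-- `L²(0, l)`. -/
abbrev L2 (l : ℝ) : Type := Lp ℝ 2 (vol 0 l)

/-- The Sobolev space `H¹(0, l)`: all pairs `(f, f')` in `L²(0, l) × L²(0, l)` such that `f'` is the
weak derivative of `f`. Its norm is `(‖f‖² + ‖f'‖²)^(1/2)`. -/
def H1 (l : ℝ) : Submodule ℝ (WithLp 2 (L2 l × L2 l)) where
  carrier := {p | IsWeakDeriv 0 l p.fst p.snd}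
  zero_mem' := IsWeakDeriv.zero.congr (Lp.coeFn_zero _ _ _) (Lp.coeFn_zero _ _ _)
  add_mem' {p q} hp hq :=
    (IsWeakDeriv.add hp hq (Lp.memLp _) (Lp.memLp _) (Lp.memLp _) (Lp.memLp _)).congr
      (Lp.coeFn_add p.fst q.fst) (Lp.coeFn_add p.snd q.snd)
  smul_mem' c p hp :=
    (IsWeakDeriv.smul c hp).congr (Lp.coeFn_smul c p.fst) (Lp.coeFn_smul c p.snd)

instance {l : ℝ} : NormedAddCommGroup (H1 l) := inferInstance

instance {l : ℝ} : InnerProductSpace ℝ (H1 l) := inferInstance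

instance {l : ℝ} : NormedSpace ℝ (H1 l) := inferInstance

variable {N : ℕ}

/-- `𝕃² = ∏ᵢ L²(0, lᵢ)`, with the norm `(∑ᵢ ‖fᵢ‖²)^(1/2)`. -/
abbrev LL2 (l : Fin N → ℝ) : Type := PiLp 2 fun i => L2 (l i)

instance {l : Fin N → ℝ} : NormedAddCommGroup (LL2 l) := inferInstance

instance {l : Fin N → ℝ} : InnerProductSpace ℝ (LL2 l) := inferInstance

instance {l : Fin N → ℝ} : NormedSpace ℝ (LL2 l) := inferInstance

/-- `ℍ¹ = ∏ᵢ H¹(0, lᵢ)`, with the norm `(∑ᵢ ‖φᵢ‖²)^(1/2)`. -/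
abbrev HH1 (l : Fin N → ℝ) : Type := PiLp 2 fun i => H1 (l i)

instance {l : Fin N → ℝ} : NormedAddCommGroup (HH1 l) := inferInstance

instance {l : Fin N → ℝ} : InnerProductSpace ℝ (HH1 l) := inferInstance

instance {l : Fin N → ℝ} : NormedSpace ℝ (HH1 l) := inferInstance

/-- The function `φᵢ ∈ L²(0, lᵢ)` underlying the component `i` of `φ ∈ ℍ¹`. -/
def val {l : Fin N → ℝ} (φ : HH1 l) (i : Fin N) : L2 (l i) :=
  (φ i : WithLp 2 (L2 (l i) × L2 (l i))).fst

/-- The weak derivative `∂φᵢ/∂x ∈ L²(0, lᵢ)` of the component `i` of `φ ∈ ℍ¹`. -/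
def dx {l : Fin N → ℝ} (φ : HH1 l) (i : Fin N) : L2 (l i) :=
  (φ i : WithLp 2 (L2 (l i) × L2 (l i))).snd

/-- `F` is the family of continuous representatives on `[0, lᵢ]` of the components of `φ`. -/
def IsContRep {l : Fin N → ℝ} (φ : HH1 l) (F : Fin N → ℝ → ℝ) : Prop :=
  ∀ i, ContinuousOn (F i) (Icc 0 (l i)) ∧ F i =ᵐ[vol 0 (l i)] val φ i

/-- `𝕍 = {φ ∈ ℍ¹ : φᵢ(0) = φⱼ(0), φᵢ(lᵢ) = 0 for all i, j}`, with the norm of `ℍ¹`. The point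
values are those of the continuous representatives. -/
def V (l : Fin N → ℝ) : Submodule ℝ (HH1 l) where
  carrier := {φ | ∃ F : Fin N → ℝ → ℝ, IsContRep φ F ∧
    (∀ i j, F i 0 = F j 0) ∧ ∀ i, F i (l i) = 0}
  zero_mem' := ⟨0, fun i => ⟨continuousOn_const, (Lp.coeFn_zero ℝ 2 (vol 0 (l i))).symm⟩,
    fun _ _ => rfl, fun _ => rfl⟩
  add_mem' := by
    rintro φ χ ⟨F, hF, hF0, hFl⟩ ⟨G, hG, hG0, hGl⟩
    refine ⟨F + G, fun i => ⟨(hF i).1.add (hG i).1, ?_⟩, fun i j => ?_, fun i => ?_⟩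
    · exact ((hF i).2.add (hG i).2).trans (Lp.coeFn_add (val φ i) (val χ i)).symm
    · simp [hF0 i j, hG0 i j]
    · simp [hFl i, hGl i]
  smul_mem' := by
    rintro c φ ⟨F, hF, hF0, hFl⟩
    refine ⟨c • F, fun i => ⟨(hF i).1.const_smul c, ?_⟩, fun i j => ?_, fun i => ?_⟩
    · exact ((hF i).2.const_smul c).trans (Lp.coeFn_smul c (val φ i)).symm
    · simp [hF0 i j]
    · simp [hFl i]

instance {l : Fin N → ℝ} : NormedAddCommGroup (V l) := inferInstance

instance {l : Fin N → ℝ} : InnerProductSpace ℝ (V l) := inferInstance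

instance {l : Fin N → ℝ} : NormedSpace ℝ (V l) := inferInstance

/-- The embedding `𝕍 ↪ 𝕃²`. -/
def toLL2 (l : Fin N → ℝ) : V l →L[ℝ] LL2 l :=
  ((PiLp.continuousLinearEquiv 2 ℝ fun i => L2 (l i)).symm : _ →L[ℝ] LL2 l) ∘L
    (ContinuousLinearMap.pi fun i =>
      WithLp.fstL 2 ℝ (L2 (l i)) (L2 (l i)) ∘L (H1 (l i)).subtypeL ∘L
        PiLp.proj 2 (fun i => H1 (l i)) i) ∘L (V l).subtypeL

lemma toLL2_apply (l : Fin N → ℝ) (φ : V l) (i : Fin N) : toLL2 l φ i = val (φ : HH1 l) i := rfl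

/-- `𝕎(0, T)` for the triple `𝕍 ↪ 𝕃² ↪ 𝕍⋆` of the star graph. -/
abbrev W (l : Fin N → ℝ) (T : ℝ) := EvolutionSpace (toLL2 l) T

/-- `𝕃^∞ = ∏ᵢ L^∞(Qᵢ)`, `Qᵢ = (0, lᵢ) × (0, T)`, with the norm `∑ᵢ ‖uᵢ‖`. -/
abbrev LLinf (l : Fin N → ℝ) (T : ℝ) : Type :=
  PiLp 1 fun i => Lp ℝ ∞ ((volume : Measure (ℝ × ℝ)).restrict (Ioo 0 (l i) ×ˢ Ioo 0 T))

/-! ### The state equation -/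

/-- The form `ℱ[u](ρ, φ) = ∑ᵢ ∫₀^{lᵢ} (Dᵢ ∂ₓρᵢ + uᵢ(·, t) ρᵢ) ∂ₓφᵢ dx` at the time `t`. -/
def form {l : Fin N → ℝ} {T : ℝ} (D : Fin N → ℝ) (u : LLinf l T) (t : ℝ) (ρ φ : V l) : ℝ :=
  ∑ i, ∫ x in Ioo 0 (l i),
    (D i * dx (ρ : HH1 l) i x + u i (x, t) * val (ρ : HH1 l) i x) * dx (φ : HH1 l) i x

/-- `ρ ∈ 𝕎(0, T)` is a weak solution of the controlled Fokker–Planck equation with diffusion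
coefficients `D`, control `u` and initial value `ρ0`: for every `φ ∈ 𝕍`,
`d/dt (ρ(·), φ) + ℱ[u](ρ(·), φ) = 0` in `𝓓'(0, T)`, and `ρ(·, 0) = ρ0` in `𝕃²` (for the
representative of `ρ` in `C([0, T]; 𝕃²)`). -/
def IsWeakSolution {l : Fin N → ℝ} {T : ℝ} (hT : 0 ≤ T) (D : Fin N → ℝ) (u : LLinf l T)
    (ρ0 : LL2 l) (ρ : W l T) : Prop :=
  (∀ φ : V l, ∀ ψ : 𝓓(interval 0 T, ℝ),
    - (∫ t, deriv ψ t * inner ℝ (toLL2 l (EvolutionSpace.toL2T ρ t)) (toLL2 l φ) ∂(vol 0 T))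
      + ∫ t, ψ t * form D u t (EvolutionSpace.toL2T ρ t) φ ∂(vol 0 T) = 0) ∧
  ∃ r : C(Icc (0 : ℝ) T, LL2 l), IsTimeContRep ρ r ∧ r ⟨0, left_mem_Icc.2 hT⟩ = ρ0

end StarGraph

end

/-!
The problem is an instance of `d/dt (j ρ, j φ) + (A(t) ρ, φ) = 0` for a triple `𝕍 ↪ 𝕃² ↪ 𝕍⋆`, where
`A(t)` represents the form `ℱ[u]`. It is coercive up to a multiple of the `𝕃²`-norm, with constants
that only involve `min Dᵢ` and `‖u‖` (`formOp_coercive`), and bounded by `max Dᵢ + ‖u‖`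
(`norm_formOp_le`). All functionals are transported to `𝕍` by the Riesz isomorphism: the embedding
`𝕍 → 𝕍⋆` becomes the operator `gram j = j† j`, and the equation reads `(j† j ρ)' = -A ρ` in
`L²(0, T; 𝕍)`. By the lemma of Du Bois-Reymond this means that `j† j ρ` is a primitive of `-A ρ`, so
the only calculus in time is the product rule for primitives, which is Fubini's theorem
(`integral_bilin_primitive`).

Existence (`exists_gram_eq_sub_primitive`) follows from Lions' projection theorem
(`exists_inner_eq_of_le_norm`). The test functions are the primitives `Φ` with `Φ(T) = 0`, and testing
the adjoint equation with `e^{2λt} Φ` gives the lower bound that the projection theorem requires.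

The continuous representative and the energy identity `‖r(t)‖² = ‖r(0)‖² + 2 ∫₀ᵗ (g, ρ)` for
`(j† j ρ)' = g` (`exists_continuousRep_and_energy`) hold for primitives in `𝕍` by the product rule. A
general `ρ` is approximated by `(ε + j† j)⁻¹ j† j ρ`, that is by a regularization in space rather than
in time: these functions are primitives in `𝕍`, they converge to `ρ` in `L²(0, T; 𝕍)`, and the energy
identity for differences makes them a Cauchy sequence in `C([0, T]; ℍ)`. With Grönwall's inequality the
energy identity yields the a priori estimates (`apriori_estimates`), and uniqueness by linearity.

On the graph it remains to see that `𝕍` is complete, because the boundary values are continuous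
functionals on `H¹(0, l)` (`continuousRep_boundary`), that it is dense in `𝕃²`
(`eq_zero_of_inner_toLL2`), and that `t ↦ A(t) ρ` is strongly measurable, because `L²(0, l)` is
separable (`stronglyMeasurable_of_sections`).
-/

set_option linter.unusedSectionVars false

noncomputable section

namespace StarGraph

/-! ### Calculus for primitives of integrable functions -/

section Primitive

variable {E F G : Type*} [NormedAddCommGroup E] [NormedSpace ℝ E]
  [NormedAddCommGroup F] [NormedSpace ℝ F] [NormedAddCommGroup G] [NormedSpace ℝ G]
  {a b : ℝ}

lemma intervalIntegral_eq_integral_vol (hab : a ≤ b) (f : ℝ → E) :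
    ∫ t in a..b, f t = ∫ t, f t ∂(vol a b) := by
  rw [intervalIntegral.integral_of_le hab, integral_Ioc_eq_integral_Ioo]

lemma intervalIntegrable_of_integrable_vol (hab : a ≤ b) {f : ℝ → E}
    (hf : Integrable f (vol a b)) : IntervalIntegrable f volume a b :=
  (intervalIntegrable_iff_integrableOn_Ioo_of_le hab).2 hf

lemma integrable_vol_mono {s t : ℝ} (has : a ≤ s) (htb : t ≤ b) {f : ℝ → E}
    (hf : Integrable f (vol a b)) : Integrable f (vol s t) :=
  hf.mono_measure (Measure.restrict_mono (Ioo_subset_Ioo has htb) le_rfl)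

lemma continuousOn_primitive (hab : a ≤ b) {f : ℝ → E} (hf : Integrable f (vol a b)) :
    ContinuousOn (fun t => ∫ s in a..t, f s) (Icc a b) := by
  have := intervalIntegral.continuousOn_primitive_interval (a := a) (b := b) (f := f)
    (μ := volume) ?_
  · rwa [uIcc_of_le hab] at this
  · rw [uIcc_of_le hab, integrableOn_Icc_iff_integrableOn_Ioo]
    exact hf

lemma norm_primitive_le {f : ℝ → E} (hf : Integrable f (vol a b)) {t : ℝ}
    (ht : t ∈ Icc a b) : ‖∫ s in a..t, f s‖ ≤ ∫ s, ‖f s‖ ∂(vol a b) := by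
  rw [intervalIntegral_eq_integral_vol ht.1]
  refine (norm_integral_le_integral_norm _).trans ?_
  exact integral_mono_measure (Measure.restrict_mono (Ioo_subset_Ioo le_rfl ht.2) le_rfl)
    (Filter.Eventually.of_forall fun _ => norm_nonneg _) hf.norm

lemma integral_indicator_Iic_vol {t : ℝ} (ht : t ∈ Ioo a b) (f : ℝ → E) :
    ∫ s, (Iic t).indicator f s ∂(vol a b) = ∫ s in a..t, f s := by
  rw [integral_indicator measurableSet_Iic, Measure.restrict_restrict measurableSet_Iic,
    intervalIntegral.integral_of_le ht.1.le]
  congr 2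
  ext s
  simp only [mem_inter_iff, mem_Iic, mem_Ioo, mem_Ioc]
  exact ⟨fun h => ⟨h.2.1, h.1⟩, fun h => ⟨h.2, h.1, h.2.trans_lt ht.2⟩⟩

lemma integral_indicator_Iio_vol {t : ℝ} (ht : t ∈ Ioo a b) (f : ℝ → E) :
    ∫ s, (Iio t).indicator f s ∂(vol a b) = ∫ s in a..t, f s := by
  rw [integral_indicator measurableSet_Iio, Measure.restrict_restrict measurableSet_Iio,
    intervalIntegral_eq_integral_vol ht.1.le]
  congr 2
  ext s
  simp only [mem_inter_iff, mem_Iio, mem_Ioo]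
  exact ⟨fun h => ⟨h.2.1, h.1⟩, fun h => ⟨h.2, h.1, h.2.trans ht.2⟩⟩

variable [CompleteSpace E] [CompleteSpace F] [CompleteSpace G]

/-- The product rule for primitives that vanish at `a`: the two terms are the integrals of
`(t, s) ↦ B (f t) (g s)` over the two triangles into which the diagonal cuts the square. -/
lemma integral_bilin_primitive_zero (B : E →L[ℝ] F →L[ℝ] G) {f : ℝ → E} {g : ℝ → F}
    (hf : Integrable f (vol a b)) (hg : Integrable g (vol a b)) :
    ∫ t, B (f t) (∫ s in a..t, g s) ∂(vol a b) + ∫ t, B (∫ s in a..t, f s) (g t) ∂(vol a b)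
      = B (∫ t, f t ∂(vol a b)) (∫ t, g t ∂(vol a b)) := by
  have hF : Integrable (fun p : ℝ × ℝ => B (f p.1) (g p.2)) ((vol a b).prod (vol a b)) :=
    Integrable.op_fst_snd (op := fun x y => B x y) B.continuous₂
      ⟨‖B‖, fun x y => B.le_opNorm₂ x y⟩ hf hg
  have hS : MeasurableSet {p : ℝ × ℝ | p.2 ≤ p.1} := measurableSet_le measurable_snd measurable_fst
  have h1 : ∫ t, B (f t) (∫ s in a..t, g s) ∂(vol a b) =
      ∫ p, {p : ℝ × ℝ | p.2 ≤ p.1}.indicator (fun p => B (f p.1) (g p.2)) p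
        ∂((vol a b).prod (vol a b)) := by
    rw [integral_prod _ (hF.indicator hS)]
    refine setIntegral_congr_fun measurableSet_Ioo fun t ht => ?_
    rw [← integral_indicator_Iic_vol ht, ← (B (f t)).integral_comp_comm
      (hg.indicator measurableSet_Iic)]
    refine integral_congr_ae (Filter.Eventually.of_forall fun s => ?_)
    by_cases h : s ≤ t <;> simp [indicator, h]
  have h2 : ∫ t, B (∫ s in a..t, f s) (g t) ∂(vol a b) =
      ∫ p, {p : ℝ × ℝ | p.2 ≤ p.1}ᶜ.indicator (fun p => B (f p.1) (g p.2)) p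
        ∂((vol a b).prod (vol a b)) := by
    rw [integral_prod_symm _ (hF.indicator hS.compl)]
    refine setIntegral_congr_fun measurableSet_Ioo fun t ht => ?_
    rw [← integral_indicator_Iio_vol ht, ← ContinuousLinearMap.flip_apply,
      ← (B.flip (g t)).integral_comp_comm (hf.indicator measurableSet_Iio)]
    refine integral_congr_ae (Filter.Eventually.of_forall fun s => ?_)
    by_cases h : s < t
    · simp [indicator, h]
    · simp [indicator, h, not_lt.1 h]
  rw [h1, h2, ← integral_add (hF.indicator hS) (hF.indicator hS.compl)]
  simp only [indicator_self_add_compl_apply]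
  rw [integral_prod _ hF]
  dsimp only
  simp_rw [fun t => (B (f t)).integral_comp_comm hg]
  rw [← ContinuousLinearMap.flip_apply, ← (B.flip _).integral_comp_comm hf]
  rfl

lemma aestronglyMeasurable_primitive (hab : a ≤ b) {f : ℝ → E} (hf : Integrable f (vol a b)) :
    AEStronglyMeasurable (fun t => ∫ s in a..t, f s) (vol a b) :=
  ((continuousOn_primitive hab hf).mono Ioo_subset_Icc_self).aestronglyMeasurable
    measurableSet_Ioo

lemma integrable_bilin_primitive_right (hab : a ≤ b) (B : E →L[ℝ] F →L[ℝ] G) {f : ℝ → E}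
    {g : ℝ → F} (d : F) (hf : Integrable f (vol a b)) (hg : Integrable g (vol a b)) :
    Integrable (fun t => B (f t) (d + ∫ s in a..t, g s)) (vol a b) := by
  refine B.flip.integrable_of_bilin_of_bdd_left (f := fun t => d + ∫ s in a..t, g s)
    (‖d‖ + ∫ s, ‖g s‖ ∂(vol a b))
    (aestronglyMeasurable_const.add (aestronglyMeasurable_primitive hab hg)) ?_ hf
  refine (ae_restrict_iff' measurableSet_Ioo).2 (Filter.Eventually.of_forall fun t ht => ?_)
  exact (norm_add_le _ _).trans (add_le_add_right (norm_primitive_le hg (Ioo_subset_Icc_self ht)) _)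

lemma integrable_bilin_primitive_left (hab : a ≤ b) (B : E →L[ℝ] F →L[ℝ] G) {f : ℝ → E}
    {g : ℝ → F} (c : E) (hf : Integrable f (vol a b)) (hg : Integrable g (vol a b)) :
    Integrable (fun t => B (c + ∫ s in a..t, f s) (g t)) (vol a b) :=
  integrable_bilin_primitive_right hab B.flip c hg hf

/-- The product rule for a continuous bilinear map of two primitives, in integrated form. -/
theorem integral_bilin_primitive (hab : a ≤ b) (B : E →L[ℝ] F →L[ℝ] G) {f : ℝ → E} {g : ℝ → F}
    (c : E) (d : F) (hf : Integrable f (vol a b)) (hg : Integrable g (vol a b)) :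
    ∫ t, B (f t) (d + ∫ s in a..t, g s) ∂(vol a b)
      + ∫ t, B (c + ∫ s in a..t, f s) (g t) ∂(vol a b)
      = B (c + ∫ t in a..b, f t) (d + ∫ t in a..b, g t) - B c d := by
  have h1 := integrable_bilin_primitive_right hab B 0 hf hg
  have h2 := integrable_bilin_primitive_left hab B 0 hf hg
  simp only [zero_add] at h1 h2
  have e1 : ∫ t, B (f t) (d + ∫ s in a..t, g s) ∂(vol a b) =
      B (∫ t, f t ∂(vol a b)) d + ∫ t, B (f t) (∫ s in a..t, g s) ∂(vol a b) := by
    simp only [map_add]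
    rw [integral_add (f := fun t => B (f t) d) ((B.flip d).integrable_comp hf) h1]
    exact congrArg (· + _) ((B.flip d).integral_comp_comm hf)
  have e2 : ∫ t, B (c + ∫ s in a..t, f s) (g t) ∂(vol a b) =
      B c (∫ t, g t ∂(vol a b)) + ∫ t, B (∫ s in a..t, f s) (g t) ∂(vol a b) := by
    simp only [map_add, add_apply]
    rw [integral_add ((B c).integrable_comp hg) h2, (B c).integral_comp_comm hg]
  rw [e1, e2, intervalIntegral_eq_integral_vol hab, intervalIntegral_eq_integral_vol hab]
  have := integral_bilin_primitive_zero B hf hg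
  simp only [map_add, add_apply]
  rw [← this]
  abel

end Primitive

/-! ### Functions with an integrable weak derivative are primitives -/

section DuBoisReymond

variable {E : Type*} [NormedAddCommGroup E] [NormedSpace ℝ E] {a b : ℝ}

lemma testFunction_eq_zero (ψ : 𝓓(interval a b, ℝ)) {t : ℝ} (ht : t ∉ Ioo a b) : ψ t = 0 :=
  image_eq_zero_of_notMem_tsupport fun h => ht (ψ.tsupport_subset h)

lemma hasDerivAt_testFunction (ψ : 𝓓(interval a b, ℝ)) (t : ℝ) :
    HasDerivAt ψ (deriv ψ t) t :=
  ((ψ.contDiff.differentiable (by simp)) t).hasDerivAt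

lemma continuous_deriv_testFunction (ψ : 𝓓(interval a b, ℝ)) : Continuous (deriv ψ) :=
  ψ.contDiff.continuous_deriv (by simp)

lemma integral_deriv_testFunction (ψ : 𝓓(interval a b, ℝ)) (t : ℝ) :
    ∫ s in a..t, deriv ψ s = ψ t := by
  rw [intervalIntegral.integral_eq_sub_of_hasDerivAt (fun s _ => hasDerivAt_testFunction ψ s)
    ((continuous_deriv_testFunction ψ).intervalIntegrable _ _),
    testFunction_eq_zero ψ (t := a) (by simp), sub_zero]

lemma integrable_vol_of_continuous {f : ℝ → E} (hf : Continuous f) : Integrable f (vol a b) :=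
  (hf.continuousOn.integrableOn_compact isCompact_Icc).mono_set Ioo_subset_Icc_self

lemma integrable_testFunction_smul' (ψ : 𝓓(interval a b, ℝ)) {f : ℝ → E}
    (hf : Integrable f (vol a b)) : Integrable (fun t => ψ t • f t) (vol a b) := by
  obtain ⟨C, hC⟩ := ψ.hasCompactSupport.exists_bound_of_continuous ψ.contDiff.continuous
  exact hf.bdd_smul C
    ψ.contDiff.continuous.aestronglyMeasurable (Filter.Eventually.of_forall hC)

lemma integrable_deriv_testFunction_smul' (ψ : 𝓓(interval a b, ℝ)) {f : ℝ → E}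
    (hf : Integrable f (vol a b)) : Integrable (fun t => deriv ψ t • f t) (vol a b) := by
  obtain ⟨C, hC⟩ := ψ.hasCompactSupport.deriv.exists_bound_of_continuous
    (continuous_deriv_testFunction ψ)
  exact hf.bdd_smul C (continuous_deriv_testFunction ψ).aestronglyMeasurable
    (Filter.Eventually.of_forall hC)

/-- A function that annihilates all test functions on `(a, b)` vanishes almost everywhere. -/
lemma ae_eq_zero_of_integral_testFunction [CompleteSpace E] {f : ℝ → E}
    (hf : Integrable f (vol a b))
    (h : ∀ ψ : 𝓓(interval a b, ℝ), ∫ t, ψ t • f t ∂(vol a b) = 0) : f =ᵐ[vol a b] 0 := by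
  have := IsOpen.ae_eq_zero_of_integral_contDiff_smul_eq_zero (μ := volume) (f := f)
    (isOpen_Ioo (a := a) (b := b)) (IntegrableOn.locallyIntegrableOn hf) ?_
  · exact (ae_restrict_iff' measurableSet_Ioo).2 this
  · intro g hg hc hs
    have := h ⟨g, hg, hc, hs⟩
    rw [← setIntegral_eq_integral_of_forall_compl_eq_zero (s := Ioo a b)]
    · exact this
    · intro t ht
      rw [image_eq_zero_of_notMem_tsupport fun h => ht (hs h), zero_smul]

lemma IsWeakDeriv.primitive [CompleteSpace E] (hab : a ≤ b) {g : ℝ → E} (c : E)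
    (hg : Integrable g (vol a b)) : IsWeakDeriv a b (fun t => c + ∫ s in a..t, g s) g := by
  intro ψ
  have := integral_bilin_primitive hab (ContinuousLinearMap.lsmul ℝ ℝ : ℝ →L[ℝ] E →L[ℝ] E) 0 c
    (integrable_vol_of_continuous (continuous_deriv_testFunction ψ)) hg
  simp only [ContinuousLinearMap.lsmul_apply, zero_add, integral_deriv_testFunction,
    testFunction_eq_zero ψ (t := b) (by simp), zero_smul, sub_zero] at this
  exact eq_neg_of_add_eq_zero_left this

lemma exists_Icc_of_isCompact_subset_Ioo {K : Set ℝ} (hab : a < b) (hK : IsCompact K)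
    (h : K ⊆ Ioo a b) : ∃ c d, a < c ∧ c ≤ d ∧ d < b ∧ K ⊆ Icc c d := by
  rcases K.eq_empty_or_nonempty with rfl | hne
  · obtain ⟨c, hc⟩ := exists_between hab
    exact ⟨c, c, hc.1, le_rfl, hc.2, empty_subset _⟩
  · obtain ⟨c, hc⟩ := hK.exists_isLeast hne
    obtain ⟨d, hd⟩ := hK.exists_isGreatest hne
    exact ⟨c, d, (h hc.1).1, hc.2 hd.1, (h hd.1).2, fun x hx => ⟨hc.2 hx, hd.2 hx⟩⟩

/-- A test function with vanishing integral is the derivative of a test function. -/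
lemma exists_deriv_eq_testFunction (hab : a < b) (ω : 𝓓(interval a b, ℝ))
    (hω : ∫ t in a..b, ω t = 0) : ∃ χ : 𝓓(interval a b, ℝ), deriv χ = ω := by
  obtain ⟨c, d, hac, hcd, hdb, hK⟩ :=
    exists_Icc_of_isCompact_subset_Ioo hab ω.hasCompactSupport ω.tsupport_subset
  have hz : ∀ t, t ∉ Icc c d → ω t = 0 := fun t ht =>
    image_eq_zero_of_notMem_tsupport fun h => ht (hK h)
  have hd : ∀ t, HasDerivAt (fun t => ∫ s in a..t, ω s) (ω t) t := fun t =>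
    (ω.continuous.integral_hasStrictDerivAt a t).hasDerivAt
  have hderiv : deriv (fun t => ∫ s in a..t, ω s) = ω := funext fun t => (hd t).deriv
  have hsupp : Function.support (fun t => ∫ s in a..t, ω s) ⊆ Icc c d := by
    intro t ht
    by_contra hcon
    apply ht
    rcases lt_or_ge t c with h | h
    · refine (intervalIntegral.integral_congr (g := fun _ => (0 : ℝ)) fun s hs => hz s ?_).trans
        (by simp)
      have := (mem_uIcc.1 hs)
      rintro ⟨h1, -⟩
      rcases this with h' | h' <;> linarith
    · have htd : d < t := by
        by_contra h'
        exact hcon ⟨h, not_lt.1 h'⟩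
      have : ∫ s in t..b, ω s = 0 := by
        refine (intervalIntegral.integral_congr (g := fun _ => (0 : ℝ)) fun s hs => hz s ?_).trans
          (by simp)
        have := (mem_uIcc.1 hs)
        rintro ⟨-, h1⟩
        rcases this with h' | h' <;> linarith
      dsimp only
      rw [← hω, ← intervalIntegral.integral_add_adjacent_intervals
        (ω.continuous.intervalIntegrable a t) (ω.continuous.intervalIntegrable t b), this, add_zero]
  have hts : tsupport (fun t => ∫ s in a..t, ω s) ⊆ Icc c d :=
    closure_minimal hsupp isClosed_Icc
  refine ⟨⟨fun t => ∫ s in a..t, ω s, ?_, ?_, ?_⟩, ?_⟩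
  · refine contDiff_infty_iff_deriv.2 ⟨fun t => (hd t).differentiableAt, ?_⟩
    rw [hderiv]
    exact ω.contDiff
  · exact HasCompactSupport.of_support_subset_isCompact isCompact_Icc hsupp
  · exact hts.trans fun x hx => ⟨hac.trans_le hx.1, hx.2.trans_lt hdb⟩
  · exact hderiv

lemma exists_testFunction_integral_eq_one (hab : a < b) :
    ∃ η : 𝓓(interval a b, ℝ), ∫ t in a..b, η t = 1 := by
  let β : ContDiffBump ((a + b) / 2) := ⟨(b - a) / 8, (b - a) / 4, by linarith, by linarith⟩
  have hs : tsupport (β.normed volume) ⊆ Ioo a b := by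
    rw [β.tsupport_normed_eq]
    intro x hx
    have : |x - (a + b) / 2| ≤ (b - a) / 4 := hx
    rw [abs_le] at this
    constructor <;> linarith
  refine ⟨⟨β.normed volume, β.contDiff_normed, β.hasCompactSupport_normed, hs⟩, ?_⟩
  have h1 := β.integral_normed (μ := volume)
  rw [intervalIntegral_eq_integral_vol hab.le]
  rw [← setIntegral_eq_integral_of_forall_compl_eq_zero (s := Ioo a b)] at h1
  · exact h1
  · exact fun t ht => image_eq_zero_of_notMem_tsupport fun h => ht (hs h)

/-- **Du Bois-Reymond**: an integrable function with an integrable weak derivative is, up to a null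
set, a primitive of that derivative. -/
theorem IsWeakDeriv.exists_ae_eq_primitive [CompleteSpace E] (hab : a < b) {f g : ℝ → E}
    (hf : Integrable f (vol a b)) (hg : Integrable g (vol a b)) (h : IsWeakDeriv a b f g) :
    ∃ c : E, f =ᵐ[vol a b] fun t => c + ∫ s in a..t, g s := by
  have hP : Integrable (fun t => ∫ s in a..t, g s) (vol a b) := by
    have := integrable_bilin_primitive_right hab.le
      (ContinuousLinearMap.lsmul ℝ ℝ : ℝ →L[ℝ] E →L[ℝ] E) 0
      (f := fun _ => (1 : ℝ)) (integrable_const _) hg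
    simpa using this
  have hk : Integrable (fun t => f t - ∫ s in a..t, g s) (vol a b) := hf.sub hP
  set k : ℝ → E := fun t => f t - ∫ s in a..t, g s with hk_def
  have hk0 : ∀ ψ : 𝓓(interval a b, ℝ), ∫ t, deriv ψ t • k t ∂(vol a b) = 0 := by
    intro ψ
    have h2 := IsWeakDeriv.primitive hab.le 0 hg ψ
    simp only [zero_add] at h2
    simp only [hk_def, smul_sub]
    rw [integral_sub (integrable_deriv_testFunction_smul' ψ hf)
      (integrable_deriv_testFunction_smul' ψ hP), h ψ, h2, sub_self]
  obtain ⟨η, hη⟩ := exists_testFunction_integral_eq_one hab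
  refine ⟨∫ t, η t • k t ∂(vol a b), ?_⟩
  have key := ae_eq_zero_of_integral_testFunction
    (hk.sub (integrable_const (∫ t, η t • k t ∂(vol a b)))) ?_
  · filter_upwards [key] with t ht
    have := sub_eq_zero.1 ht
    simp only [hk_def] at this
    rw [sub_eq_iff_eq_add] at this
    exact this
  · intro ψ
    obtain ⟨χ, hχ⟩ := exists_deriv_eq_testFunction hab (ψ - (∫ t in a..b, ψ t) • η) (by
      simp only [FunLike.coe_sub, FunLike.coe_smul, Pi.sub_apply, Pi.smul_apply, smul_eq_mul]
      rw [intervalIntegral.integral_sub (ψ.continuous.intervalIntegrable _ _)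
        ((η.continuous.intervalIntegrable _ _).const_mul _),
        intervalIntegral.integral_const_mul, hη, mul_one, sub_self])
    have h0 := hk0 χ
    rw [hχ] at h0
    simp only [FunLike.coe_sub, FunLike.coe_smul, Pi.sub_apply, Pi.smul_apply, smul_eq_mul,
      sub_smul, mul_smul] at h0
    rw [integral_sub (f := fun t => ψ t • k t) (g := fun t => (∫ t in a..b, ψ t) • (η t • k t))
      (integrable_testFunction_smul' ψ hk)
      ((integrable_testFunction_smul' η hk).smul _), integral_smul] at h0
    simp only [Pi.sub_apply, smul_sub]
    rw [integral_sub (integrable_testFunction_smul' ψ hk)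
      (integrable_testFunction_smul' ψ (integrable_const _)), integral_smul_const, ← h0,
      intervalIntegral_eq_integral_vol hab.le]

end DuBoisReymond

/-! ### Operators on Bochner spaces -/

section Operators

variable {X Y : Type*} [NormedAddCommGroup X] [NormedSpace ℝ X]
  [NormedAddCommGroup Y] [NormedSpace ℝ Y] {Ω : Type*} [MeasurableSpace Ω] {μ : Measure Ω}

/-- A family of bounded operators that is strongly measurable at each fixed vector maps strongly
measurable functions to strongly measurable functions. -/
lemma aestronglyMeasurable_clm_apply {A : Ω → X →L[ℝ] Y}
    (hA : ∀ v, AEStronglyMeasurable (fun t => A t v) μ) {w : Ω → X}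
    (hw : AEStronglyMeasurable w μ) : AEStronglyMeasurable (fun t => A t (w t)) μ := by
  have hs : ∀ s : SimpleFunc Ω X, AEStronglyMeasurable (fun t => A t (s t)) μ := by
    intro s
    have : (fun t => A t (s t)) =
        fun t => ∑ v ∈ s.range, (s ⁻¹' {v}).indicator (fun t => A t v) t := by
      funext t
      rw [Finset.sum_eq_single (s t)]
      · simp
      · intro v _ hv
        exact indicator_of_notMem (fun h => hv h.symm) _
      · intro h
        exact absurd (s.mem_range_self t) h
    rw [this]
    exact Finset.aestronglyMeasurable_fun_sum _ fun v _ =>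
      (hA v).indicator (s.measurableSet_fiber v)
  refine (aestronglyMeasurable_of_tendsto_ae Filter.atTop
    (fun n => hs (hw.stronglyMeasurable_mk.approx n)) ?_)
  filter_upwards [hw.ae_eq_mk] with t ht
  rw [ht]
  exact ((A t).continuous.tendsto _).comp (hw.stronglyMeasurable_mk.tendsto_approx t)

lemma memLp_clm_apply {A : Ω → X →L[ℝ] Y} {Λ : ℝ}
    (hA : ∀ v, AEStronglyMeasurable (fun t => A t v) μ) (hΛ : ∀ t, ‖A t‖ ≤ Λ) {w : Ω → X}
    (hw : MemLp w 2 μ) : MemLp (fun t => A t (w t)) 2 μ :=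
  hw.of_le_mul (aestronglyMeasurable_clm_apply hA hw.1)
    (Filter.Eventually.of_forall fun t => (A t).le_of_opNorm_le (hΛ t) _)

/-- The operator `w ↦ (t ↦ A t (w t))` on `L²` given by a bounded, strongly measurable family of
operators. -/
def pointwise (A : Ω → X →L[ℝ] Y) {Λ : ℝ}
    (hA : ∀ v, AEStronglyMeasurable (fun t => A t v) μ) (hΛ : ∀ t, ‖A t‖ ≤ Λ) :
    Lp X 2 μ →L[ℝ] Lp Y 2 μ :=
  LinearMap.mkContinuous
    { toFun := fun w => (memLp_clm_apply hA hΛ (Lp.memLp w)).toLp _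
      map_add' := fun w z => by
        rw [← MemLp.toLp_add]
        refine (MemLp.toLp_eq_toLp_iff _ _).2 ?_
        filter_upwards [Lp.coeFn_add w z] with t ht
        rw [Pi.add_apply, ht, Pi.add_apply, map_add]
      map_smul' := fun c w => by
        rw [RingHom.id_apply, ← MemLp.toLp_const_smul]
        refine (MemLp.toLp_eq_toLp_iff _ _).2 ?_
        filter_upwards [Lp.coeFn_smul c w] with t ht
        rw [Pi.smul_apply, ht, Pi.smul_apply, map_smul] } Λ fun w => by
    refine Lp.norm_le_mul_norm_of_ae_le_mul ?_
    filter_upwards [(memLp_clm_apply hA hΛ (Lp.memLp w)).coeFn_toLp] with t ht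
    rw [LinearMap.coe_mk, AddHom.coe_mk, ht]
    exact (A t).le_of_opNorm_le (hΛ t) _

lemma coeFn_pointwise (A : Ω → X →L[ℝ] Y) {Λ : ℝ}
    (hA : ∀ v, AEStronglyMeasurable (fun t => A t v) μ) (hΛ : ∀ t, ‖A t‖ ≤ Λ) (w : Lp X 2 μ) :
    pointwise A hA hΛ w =ᵐ[μ] fun t => A t (w t) :=
  (memLp_clm_apply hA hΛ (Lp.memLp w)).coeFn_toLp

lemma coeFn_neg_pointwise (A : Ω → X →L[ℝ] Y) {Λ : ℝ}
    (hA : ∀ v, AEStronglyMeasurable (fun t => A t v) μ) (hΛ : ∀ t, ‖A t‖ ≤ Λ) (w : Lp X 2 μ) :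
    (-pointwise A hA hΛ w : Lp Y 2 μ) =ᵐ[μ] fun t => -(A t (w t)) := by
  filter_upwards [Lp.coeFn_neg (pointwise A hA hΛ w), coeFn_pointwise A hA hΛ w] with t h1 h2
  rw [h1, Pi.neg_apply, h2]

lemma norm_pointwise_apply_le (A : Ω → X →L[ℝ] Y) {Λ : ℝ}
    (hA : ∀ v, AEStronglyMeasurable (fun t => A t v) μ) (hΛ : ∀ t, ‖A t‖ ≤ Λ) (w : Lp X 2 μ) :
    ‖pointwise A hA hΛ w‖ ≤ Λ * ‖w‖ := by
  refine Lp.norm_le_mul_norm_of_ae_le_mul ?_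
  filter_upwards [coeFn_pointwise A hA hΛ w] with t ht
  rw [ht]
  exact (A t).le_of_opNorm_le (hΛ t) _

end Operators

/-! ### Existence by Lions' projection theorem -/

/-- **Lions' projection theorem**: a functional that is bounded by `f ↦ ‖𝓔 f‖` is represented by a
vector against `𝓔`. -/
theorem exists_inner_eq_of_le_norm {X F : Type*} [NormedAddCommGroup X] [InnerProductSpace ℝ X]
    [CompleteSpace X] [AddCommGroup F] [Module ℝ F] (𝓔 : F →ₗ[ℝ] X) (L : F →ₗ[ℝ] ℝ) (C : ℝ)
    (h : ∀ f, |L f| ≤ C * ‖𝓔 f‖) : ∃ u : X, ∀ f, inner ℝ u (𝓔 f) = L f := by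
  have hker : LinearMap.ker 𝓔 ≤ LinearMap.ker L := by
    intro f hf
    have := h f
    rw [LinearMap.mem_ker.1 hf, norm_zero, mul_zero] at this
    exact LinearMap.mem_ker.2 (abs_nonpos_iff.1 this)
  let M : LinearMap.range 𝓔 →ₗ[ℝ] ℝ :=
    (LinearMap.ker 𝓔).liftQ L hker ∘ₗ (𝓔.quotKerEquivRange.symm : _ →ₗ[ℝ] _)
  have hM : ∀ f, M ⟨𝓔 f, LinearMap.mem_range_self 𝓔 f⟩ = L f := by
    intro f
    have : 𝓔.quotKerEquivRange.symm ⟨𝓔 f, LinearMap.mem_range_self 𝓔 f⟩ =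
        (LinearMap.ker 𝓔).mkQ f := by
      rw [LinearEquiv.symm_apply_eq]
      rfl
    simp only [M, LinearMap.comp_apply, LinearEquiv.coe_coe, this]
    rfl
  let M' : StrongDual ℝ (LinearMap.range 𝓔) := M.mkContinuous C (by
    rintro ⟨x, f, rfl⟩
    rw [hM]
    exact h f)
  obtain ⟨g, hg, -⟩ := exists_extension_norm_eq (LinearMap.range 𝓔) M'
  refine ⟨(InnerProductSpace.toDual ℝ X).symm g, fun f => ?_⟩
  rw [InnerProductSpace.toDual_symm_apply]
  exact (hg ⟨𝓔 f, LinearMap.mem_range_self 𝓔 f⟩).trans (hM f)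

section Gram

variable {V H : Type} [NormedAddCommGroup V] [InnerProductSpace ℝ V] [CompleteSpace V]
  [NormedAddCommGroup H] [InnerProductSpace ℝ H] [CompleteSpace H]

/-- The operator `j† j` on `𝕍`; it represents the embedding `𝕍 → 𝕍⋆` when `𝕍⋆` is identified with
`𝕍` by the Riesz isomorphism. -/
def gram (j : V →L[ℝ] H) : V →L[ℝ] V := ContinuousLinearMap.adjoint j ∘L j

lemma inner_gram (j : V →L[ℝ] H) (x y : V) : inner ℝ (gram j x) y = inner ℝ (j x) (j y) :=
  ContinuousLinearMap.adjoint_inner_left j y (j x)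

end Gram

section Existence

variable {V H : Type} [NormedAddCommGroup V] [InnerProductSpace ℝ V] [CompleteSpace V]
  [NormedAddCommGroup H] [InnerProductSpace ℝ H] [CompleteSpace H] {T : ℝ}

lemma integrable_L2T {E : Type} [NormedAddCommGroup E] (w : L2T T E) : Integrable w (vol 0 T) :=
  (Lp.memLp w).integrable one_le_two

lemma memLp_primitive (hT : 0 ≤ T) {f : ℝ → V} (hf : Integrable f (vol 0 T)) (c : V) :
    MemLp (fun t => c + ∫ s in 0..t, f s) 2 (vol 0 T) := by
  refine MemLp.of_bound (aestronglyMeasurable_const.add (aestronglyMeasurable_primitive hT hf))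
    (‖c‖ + ∫ s, ‖f s‖ ∂(vol 0 T)) ?_
  refine (ae_restrict_iff' measurableSet_Ioo).2 (Filter.Eventually.of_forall fun t ht => ?_)
  exact (norm_add_le _ _).trans (add_le_add_right (norm_primitive_le hf (Ioo_subset_Icc_self ht)) _)

lemma primitive_congr {E : Type*} [NormedAddCommGroup E] [NormedSpace ℝ E] {f g : ℝ → E}
    (h : f =ᵐ[vol 0 T] g) {t : ℝ} (ht : t ∈ Icc 0 T) :
    ∫ s in 0..t, f s = ∫ s in 0..t, g s := by
  rw [intervalIntegral_eq_integral_vol ht.1, intervalIntegral_eq_integral_vol ht.1]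
  exact integral_congr_ae
    (ae_mono (Measure.restrict_mono (Ioo_subset_Ioo le_rfl ht.2) le_rfl) h)

/-- The primitive of `f` that vanishes at the final time, `t ↦ - ∫ₜᵀ f`. -/
def backwardPrimitive (f : ℝ → V) (T t : ℝ) : V := -(∫ s in 0..T, f s) + ∫ s in 0..t, f s

lemma memLp_backwardPrimitive (hT : 0 ≤ T) (f : L2T T V) :
    MemLp (backwardPrimitive f T) 2 (vol 0 T) :=
  memLp_primitive hT (integrable_L2T f) _

/-- `f ↦ backwardPrimitive f T` as a linear map of `L²(0, T; 𝕍)`. -/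
def backwardPrimitiveL (hT : 0 ≤ T) : L2T T V →ₗ[ℝ] L2T T V where
  toFun f := (memLp_backwardPrimitive hT f).toLp _
  map_add' f g := by
    rw [← MemLp.toLp_add]
    refine (MemLp.toLp_eq_toLp_iff _ _).2
      ((ae_restrict_iff' measurableSet_Ioo).2 (Filter.Eventually.of_forall fun t ht => ?_))
    have key : ∀ t ∈ Icc 0 T, ∫ s in 0..t, (f + g : L2T T V) s =
        (∫ s in 0..t, f s) + ∫ s in 0..t, g s := by
      intro t ht
      rw [primitive_congr (Lp.coeFn_add f g) ht]
      exact intervalIntegral.integral_add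
        (intervalIntegrable_of_integrable_vol ht.1
          (integrable_vol_mono le_rfl ht.2 (integrable_L2T f)))
        (intervalIntegrable_of_integrable_vol ht.1
          (integrable_vol_mono le_rfl ht.2 (integrable_L2T g)))
    simp only [backwardPrimitive, Pi.add_apply]
    rw [key t (Ioo_subset_Icc_self ht), key T (right_mem_Icc.2 hT)]
    abel
  map_smul' c f := by
    rw [RingHom.id_apply, ← MemLp.toLp_const_smul]
    refine (MemLp.toLp_eq_toLp_iff _ _).2
      ((ae_restrict_iff' measurableSet_Ioo).2 (Filter.Eventually.of_forall fun t ht => ?_))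
    have key : ∀ t ∈ Icc 0 T, ∫ s in 0..t, (c • f : L2T T V) s = c • ∫ s in 0..t, f s := by
      intro t ht
      rw [primitive_congr (Lp.coeFn_smul c f) ht]
      exact intervalIntegral.integral_smul _ _
    simp only [backwardPrimitive, Pi.smul_apply]
    rw [key t (Ioo_subset_Icc_self ht), key T (right_mem_Icc.2 hT), smul_add, smul_neg]

lemma coeFn_backwardPrimitiveL (hT : 0 ≤ T) (f : L2T T V) :
    backwardPrimitiveL hT f =ᵐ[vol 0 T] backwardPrimitive f T :=
  (memLp_backwardPrimitive hT f).coeFn_toLp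

lemma backwardPrimitive_final (f : ℝ → V) : backwardPrimitive f T T = 0 := by
  simp [backwardPrimitive]

lemma integrable_inner_primitive (hT : 0 ≤ T) (j : V →L[ℝ] H) (c : V) {g : ℝ → V}
    (hg : Integrable g (vol 0 T)) :
    Integrable (fun s => inner ℝ (j (g s)) (j (c + ∫ r in 0..s, g r))) (vol 0 T) :=
  integrable_bilin_primitive_right hT (toDual j) c hg hg

/-- The energy identity for a primitive of a `𝕍`-valued function. -/
lemma norm_sq_primitive (j : V →L[ℝ] H) (c : V) {g : ℝ → V}
    (hg : Integrable g (vol 0 T)) {t : ℝ} (ht : t ∈ Icc 0 T) :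
    ‖j (c + ∫ s in 0..t, g s)‖ ^ 2 =
      ‖j c‖ ^ 2 + 2 * ∫ s in 0..t, inner ℝ (j (g s)) (j (c + ∫ r in 0..s, g r)) := by
  have hgt := integrable_vol_mono le_rfl ht.2 hg
  have := integral_bilin_primitive ht.1 (toDual j) c c hgt hgt
  simp only [toDual_apply, real_inner_self_eq_norm_sq] at this
  simp_rw [fun s => real_inner_comm (j (g s)) (j (c + ∫ r in 0..s, g r))] at this
  rw [intervalIntegral_eq_integral_vol ht.1 (fun s => inner ℝ (j (g s)) _)]
  linarith

/-- Differentiation of the weighted square `e^{2λt} ‖j Φ(t)‖²` along `Φ = backwardPrimitive f T`,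
integrated over `(0, T)`. -/
lemma weighted_energy (hT : 0 ≤ T) (j : V →L[ℝ] H) (lam : ℝ) (f : L2T T V) :
    2 * ∫ t, Real.exp (2 * lam * t) * inner ℝ (j (backwardPrimitive f T t)) (j (f t)) ∂(vol 0 T)
      = - ‖j (backwardPrimitive f T 0)‖ ^ 2 - 2 * lam *
        ∫ t, Real.exp (2 * lam * t) * ‖j (backwardPrimitive f T t)‖ ^ 2 ∂(vol 0 T) := by
  set d : V := -(∫ s in 0..T, f s) with hd
  have hf := integrable_L2T f
  set q : ℝ → ℝ := fun t => 2 * inner ℝ (j (f t)) (j (backwardPrimitive f T t)) with hq_def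
  have hq : Integrable q (vol 0 T) := (integrable_inner_primitive hT j d hf).const_mul 2
  have hF : ∀ t ∈ Icc 0 T, ‖j d‖ ^ 2 + ∫ s in 0..t, q s = ‖j (backwardPrimitive f T t)‖ ^ 2 := by
    intro t ht
    simp only [hq_def, backwardPrimitive, ← hd, intervalIntegral.integral_const_mul]
    exact (norm_sq_primitive j d hf ht).symm
  have hθ : ∀ t, 1 + ∫ s in 0..t, 2 * lam * Real.exp (2 * lam * s) = Real.exp (2 * lam * t) := by
    intro t
    rw [intervalIntegral.integral_eq_sub_of_hasDerivAt (f := fun s => Real.exp (2 * lam * s))]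
    · simp
    · intro s _
      have := ((hasDerivAt_id s).const_mul (2 * lam)).exp
      simpa [mul_comm] using this
    · exact Continuous.intervalIntegrable (by fun_prop) _ _
  have key := integral_bilin_primitive hT (ContinuousLinearMap.mul ℝ ℝ) 1 (‖j d‖ ^ 2)
    (f := fun s => 2 * lam * Real.exp (2 * lam * s)) (g := q)
    (integrable_vol_of_continuous (by fun_prop)) hq
  simp only [ContinuousLinearMap.mul_apply'] at key
  rw [hF T (right_mem_Icc.2 hT), backwardPrimitive_final, map_zero, norm_zero] at key
  simp only [hθ] at key
  have e1 : ∫ t, 2 * lam * Real.exp (2 * lam * t) * (‖j d‖ ^ 2 + ∫ s in 0..t, q s) ∂(vol 0 T) =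
      2 * lam * ∫ t, Real.exp (2 * lam * t) * ‖j (backwardPrimitive f T t)‖ ^ 2 ∂(vol 0 T) := by
    rw [← integral_const_mul]
    refine setIntegral_congr_fun measurableSet_Ioo fun t ht => ?_
    rw [hF t (Ioo_subset_Icc_self ht), mul_assoc]
  have e2 : ∫ t, Real.exp (2 * lam * t) * q t ∂(vol 0 T) =
      2 * ∫ t, Real.exp (2 * lam * t) * inner ℝ (j (backwardPrimitive f T t)) (j (f t))
        ∂(vol 0 T) := by
    rw [← integral_const_mul]
    refine integral_congr_ae (Filter.Eventually.of_forall fun t => ?_)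
    simp only [hq_def]
    rw [real_inner_comm]
    ring
  have e0 : backwardPrimitive f T 0 = d := by simp [backwardPrimitive, hd]
  rw [e1, e2] at key
  rw [e0]
  linarith

/-- Existence for the evolution equation `(j† j u)' + A u = 0` in integrated form. Lions' projection
theorem is applied to the test functions `Φ = backwardPrimitive f T`; the required lower bound
comes from pairing the equation for `Φ` with `e^{2λt} Φ`. -/
theorem exists_gram_eq_sub_primitive (hT : 0 ≤ T) (j : V →L[ℝ] H) {A : ℝ → V →L[ℝ] V}
    {Λ α lam : ℝ} (hα : 0 < α) (hlam : 0 ≤ lam)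
    (hA : ∀ v, AEStronglyMeasurable (fun t => A t v) (vol 0 T)) (hΛ : ∀ t, ‖A t‖ ≤ Λ)
    (hcoer : ∀ t v, α * ‖v‖ ^ 2 ≤ inner ℝ (A t v) v + lam * ‖j v‖ ^ 2) (ρ0 : H) :
    ∃ u : L2T T V, ∀ᵐ t ∂(vol 0 T), gram j (u t) =
      ContinuousLinearMap.adjoint j ρ0 - ∫ s in 0..t, A s (u s) := by
  set 𝒜 := pointwise A hA hΛ with h𝒜
  set 𝒦 : L2T T V →L[ℝ] L2T T V := (gram j).compLpL 2 (vol 0 T) with h𝒦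
  have hK : ∀ w : L2T T V, 𝒦 w =ᵐ[vol 0 T] fun t => gram j (w t) := fun w =>
    (gram j).coeFn_compLpL w
  set I := backwardPrimitiveL (V := V) hT with hI
  let 𝓔 : L2T T V →ₗ[ℝ] L2T T V :=
    (ContinuousLinearMap.adjoint 𝒜 : L2T T V →ₗ[ℝ] L2T T V) ∘ₗ I - (𝒦 : L2T T V →ₗ[ℝ] L2T T V)
  have h𝓔 : ∀ u f, inner ℝ u (𝓔 f) = inner ℝ (𝒜 u) (I f) - inner ℝ (𝒦 u) f := by
    intro u f
    have hsymm : inner ℝ u (𝒦 f) = inner ℝ (𝒦 u) f := by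
      rw [L2.inner_def, L2.inner_def]
      refine integral_congr_ae ?_
      filter_upwards [hK u, hK f] with t h1 h2
      rw [h1, h2, inner_gram, real_inner_comm, inner_gram, real_inner_comm]
    simp only [𝓔, LinearMap.sub_apply, LinearMap.comp_apply, ContinuousLinearMap.coe_coe]
    rw [inner_sub_right, ContinuousLinearMap.adjoint_inner_right, hsymm]
  let L : L2T T V →ₗ[ℝ] ℝ :=
    { toFun := fun f => - inner ℝ (ContinuousLinearMap.adjoint j ρ0) (∫ t, f t ∂(vol 0 T))
      map_add' := fun f g => by
        rw [integral_congr_ae (Lp.coeFn_add f g)]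
        simp only [Pi.add_apply]
        rw [integral_add (integrable_L2T f) (integrable_L2T g), inner_add_right, neg_add]
      map_smul' := fun c f => by
        rw [integral_congr_ae (Lp.coeFn_smul c f)]
        simp only [Pi.smul_apply]
        rw [integral_smul, inner_smul_right, RingHom.id_apply, smul_eq_mul, mul_neg] }
  have hLj : ∀ f, L f = inner ℝ ρ0 (j (backwardPrimitive f T 0)) := by
    intro f
    have : backwardPrimitive f T 0 = - ∫ t, f t ∂(vol 0 T) := by
      simp [backwardPrimitive, intervalIntegral_eq_integral_vol hT]
    rw [this, map_neg, inner_neg_right, ← ContinuousLinearMap.adjoint_inner_left]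
    rfl
  -- the weight `θ(t) = e^{2λt}`, constant for `t ≥ T` so that it is bounded everywhere
  set κ : ℝ := Real.exp (2 * lam * T) with hκ
  let θ : ℝ → ℝ := fun t => Real.exp (2 * lam * min t T)
  have hθpos : ∀ t, 0 < θ t := fun t => Real.exp_pos _
  have hθκ : ∀ t, θ t ≤ κ := fun t =>
    Real.exp_le_exp.2 (mul_le_mul_of_nonneg_left (min_le_right _ _) (by positivity))
  have hθcont : Continuous θ := by fun_prop
  have hθeq : ∀ t ∈ Ioo 0 T, θ t = Real.exp (2 * lam * t) := fun t ht => by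
    simp only [θ, min_eq_left ht.2.le]
  let Θ : L2T T V →L[ℝ] L2T T V :=
    pointwise (μ := vol 0 T) (fun t => θ t • ContinuousLinearMap.id ℝ V) (Λ := κ)
      (fun v => (hθcont.smul continuous_const).aestronglyMeasurable) (fun t => by
        rw [norm_smul, Real.norm_of_nonneg (hθpos t).le]
        exact (mul_le_of_le_one_right (hθpos t).le ContinuousLinearMap.norm_id_le).trans (hθκ t))
  have hΘ : ∀ w : L2T T V, Θ w =ᵐ[vol 0 T] fun t => θ t • w t := fun w =>
    coeFn_pointwise _ _ _ w
  have hlower : ∀ f : L2T T V, ‖j (backwardPrimitive f T 0)‖ ^ 2 / 2 + α * ‖I f‖ ^ 2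
      ≤ inner ℝ (Θ (I f)) (𝓔 f) := by
    intro f
    have hIf := coeFn_backwardPrimitiveL hT f
    have e0 : ∫ t, θ t * ‖j (I f t)‖ ^ 2 ∂(vol 0 T) =
        ∫ t, Real.exp (2 * lam * t) * ‖j (backwardPrimitive f T t)‖ ^ 2 ∂(vol 0 T) := by
      refine integral_congr_ae ?_
      filter_upwards [hIf, ae_restrict_mem measurableSet_Ioo] with t h1 h2
      rw [h1, hθeq t h2]
    have e1 : inner ℝ (𝒦 (Θ (I f))) f =
        ∫ t, Real.exp (2 * lam * t) * inner ℝ (j (backwardPrimitive f T t)) (j (f t))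
          ∂(vol 0 T) := by
      rw [L2.inner_def]
      refine integral_congr_ae ?_
      filter_upwards [hK (Θ (I f)), hΘ (I f), hIf, ae_restrict_mem measurableSet_Ioo]
        with t h1 h2 h3 h4
      rw [h1, inner_gram, h2, h3, hθeq t h4, map_smul, inner_smul_left]
      rfl
    have i1 : Integrable (fun t => θ t * inner ℝ (A t (I f t)) (I f t)) (vol 0 T) := by
      refine (L2.integrable_inner (𝕜 := ℝ) (𝒜 (Θ (I f))) (I f)).congr ?_
      filter_upwards [coeFn_pointwise A hA hΛ (Θ (I f)), hΘ (I f)] with t h1 h2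
      rw [h𝒜, h1, h2, map_smul, inner_smul_left]
      rfl
    have i2 : Integrable (fun t => θ t * ‖j (I f t)‖ ^ 2) (vol 0 T) := by
      refine (L2.integrable_inner (𝕜 := ℝ) (𝒦 (Θ (I f))) (I f)).congr ?_
      filter_upwards [hK (Θ (I f)), hΘ (I f)] with t h1 h2
      rw [h1, inner_gram, h2, map_smul, inner_smul_left, real_inner_self_eq_norm_sq]
      rfl
    have i3 : Integrable (fun t => ‖I f t‖ ^ 2) (vol 0 T) := by
      refine (L2.integrable_inner (𝕜 := ℝ) (I f) (I f)).congr
        (Filter.Eventually.of_forall fun t => ?_)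
      exact real_inner_self_eq_norm_sq _
    have e2 : inner ℝ (𝒜 (Θ (I f))) (I f) =
        ∫ t, θ t * inner ℝ (A t (I f t)) (I f t) ∂(vol 0 T) := by
      rw [L2.inner_def]
      refine integral_congr_ae ?_
      filter_upwards [coeFn_pointwise A hA hΛ (Θ (I f)), hΘ (I f)] with t h1 h2
      rw [h𝒜, h1, h2, map_smul, inner_smul_left]
      rfl
    have e3 : ‖I f‖ ^ 2 = ∫ t, ‖I f t‖ ^ 2 ∂(vol 0 T) := by
      rw [← real_inner_self_eq_norm_sq, L2.inner_def]
      simp_rw [real_inner_self_eq_norm_sq]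
    have hw := weighted_energy hT j lam f
    rw [h𝓔, e1, e2]
    rw [← e0] at hw
    have hmono : α * ∫ t, ‖I f t‖ ^ 2 ∂(vol 0 T) ≤
        ∫ t, θ t * inner ℝ (A t (I f t)) (I f t) ∂(vol 0 T) +
          lam * ∫ t, θ t * ‖j (I f t)‖ ^ 2 ∂(vol 0 T) := by
      rw [← integral_const_mul, ← integral_const_mul, ← integral_add i1 (i2.const_mul lam)]
      refine integral_mono_ae (i3.const_mul α) (i1.add (i2.const_mul lam)) ?_
      filter_upwards [ae_restrict_mem measurableSet_Ioo] with t ht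
      have h1 : 1 ≤ θ t := by
        rw [hθeq t ht]
        exact Real.one_le_exp (by have := ht.1; positivity)
      have h2 := hcoer t (I f t)
      have h3 : 0 ≤ α * ‖I f t‖ ^ 2 := by positivity
      calc α * ‖I f t‖ ^ 2 ≤ θ t * (α * ‖I f t‖ ^ 2) := le_mul_of_one_le_left h3 h1
        _ ≤ θ t * (inner ℝ (A t (I f t)) (I f t) + lam * ‖j (I f t)‖ ^ 2) :=
          mul_le_mul_of_nonneg_left h2 (hθpos t).le
        _ = _ := by ring
    rw [e3]
    linarith
  have hbound : ∀ f, |L f| ≤ ‖ρ0‖ * (κ / Real.sqrt (2 * α)) * ‖𝓔 f‖ := by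
    intro f
    have hκ0 : 0 < κ := Real.exp_pos _
    have hs : 0 < Real.sqrt (2 * α) := Real.sqrt_pos.2 (by positivity)
    have h1 := hlower f
    have h2 : inner ℝ (Θ (I f)) (𝓔 f) ≤ κ * ‖I f‖ * ‖𝓔 f‖ :=
      (real_inner_le_norm _ _).trans
        (mul_le_mul_of_nonneg_right (norm_pointwise_apply_le _ _ _ _) (norm_nonneg _))
    have h3 : ‖j (backwardPrimitive f T 0)‖ ≤ κ / Real.sqrt (2 * α) * ‖𝓔 f‖ := by
      refine abs_le_of_sq_le_sq' ?_ (by positivity) |>.2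
      rw [mul_pow, div_pow, Real.sq_sqrt (by positivity), div_mul_eq_mul_div,
        le_div_iff₀ (by positivity)]
      -- Young's inequality absorbs `‖I f‖` into the lower bound
      nlinarith [sq_nonneg (2 * α * ‖I f‖ - κ * ‖𝓔 f‖)]
    rw [hLj, mul_assoc]
    exact (abs_real_inner_le_norm _ _).trans (mul_le_mul_of_nonneg_left h3 (norm_nonneg _))
  obtain ⟨u, hu⟩ := exists_inner_eq_of_le_norm 𝓔 L _ hbound
  refine ⟨u, ?_⟩
  set h : L2T T V := 𝒜 u with hh
  have hhA : h =ᵐ[vol 0 T] fun t => A t (u t) := coeFn_pointwise A hA hΛ u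
  have hhi := integrable_L2T h
  have hm := memLp_primitive hT hhi.neg (ContinuousLinearMap.adjoint j ρ0)
  -- the product rule moves the backward primitive from `f` to `h`, so that the equation for `u` says
  -- that `z` is orthogonal to every `f`
  set z : L2T T V := hm.toLp _ - 𝒦 u with hz
  have hzero : ∀ f : L2T T V, inner ℝ z f = 0 := by
    intro f
    have h1 := hu f
    rw [h𝓔] at h1
    have hfi := integrable_L2T f
    have h2 := integral_bilin_primitive hT (toDual (ContinuousLinearMap.id ℝ V))
      (-ContinuousLinearMap.adjoint j ρ0) (-(∫ s in 0..T, f s)) hhi hfi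
    simp only [toDual_apply, ContinuousLinearMap.id_apply, neg_add_cancel, inner_zero_right, inner_neg_left,
      inner_neg_right, neg_neg, zero_sub] at h2
    have e1 : inner ℝ (𝒜 u) (I f) =
        ∫ t, inner ℝ (h t) (-(∫ s in 0..T, f s) + ∫ s in 0..t, f s) ∂(vol 0 T) := by
      rw [L2.inner_def]
      refine integral_congr_ae ?_
      filter_upwards [coeFn_backwardPrimitiveL hT f] with t h1
      rw [hI, h1, backwardPrimitive]
    have e2 : inner ℝ (hm.toLp _) f = - ∫ t, inner ℝ
        (-ContinuousLinearMap.adjoint j ρ0 + ∫ s in 0..t, h s) (f t) ∂(vol 0 T) := by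
      rw [L2.inner_def, ← integral_neg]
      refine integral_congr_ae ?_
      filter_upwards [hm.coeFn_toLp] with t h1
      rw [h1, ← inner_neg_left, neg_add, neg_neg]
      simp only [Pi.neg_apply, intervalIntegral.integral_neg]
    have e3 : L f = - inner ℝ (ContinuousLinearMap.adjoint j ρ0) (∫ t in 0..T, f t) := by
      rw [intervalIntegral_eq_integral_vol hT]
      rfl
    rw [hz, inner_sub_left, e2]
    rw [e1, e3] at h1
    linarith
  have hz0 : z = 0 := inner_self_eq_zero.1 (hzero z)
  have : hm.toLp _ = 𝒦 u := sub_eq_zero.1 hz0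
  have hae : 𝒦 u =ᵐ[vol 0 T] _ := this ▸ hm.coeFn_toLp
  filter_upwards [hae, hK u, ae_restrict_mem measurableSet_Ioo] with t h1 h2 h3
  rw [← h2, h1, sub_eq_add_neg, ← primitive_congr hhA (Ioo_subset_Icc_self h3)]
  simp

end Existence

/-! ### The energy identity in the evolution space -/

section Energy

open Filter Topology

variable {V H : Type} [NormedAddCommGroup V] [InnerProductSpace ℝ V] [CompleteSpace V]
  [NormedAddCommGroup H] [InnerProductSpace ℝ H] [CompleteSpace H] {T : ℝ}

lemma gram_add_smul_injective (j : V →L[ℝ] H) {ε : ℝ} (hε : 0 < ε) {x y : V}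
    (h : ε • x + gram j x = ε • y + gram j y) : x = y := by
  have h1 : ε • (x - y) + gram j (x - y) = 0 := by
    rw [smul_sub, map_sub, sub_add_sub_comm, h, sub_self]
  have h2 : ε * ‖x - y‖ ^ 2 + ‖j (x - y)‖ ^ 2 = 0 := by
    have := congrArg (fun z => inner ℝ z (x - y)) h1
    simp only [inner_add_left, inner_smul_left, inner_gram, real_inner_self_eq_norm_sq,
      inner_zero_left] at this
    exact this
  have h3 : ‖x - y‖ ^ 2 = 0 := by
    nlinarith [sq_nonneg ‖x - y‖, sq_nonneg ‖j (x - y)‖, mul_nonneg hε.le (sq_nonneg ‖x - y‖)]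
  exact sub_eq_zero.1 (norm_eq_zero.1 (pow_eq_zero_iff two_ne_zero |>.1 h3))

lemma exists_resolvent (j : V →L[ℝ] H) {ε : ℝ} (hε : 0 < ε) :
    ∃ R : V →L[ℝ] V, ∀ x, ε • R x + gram j (R x) = x := by
  let B : V →L[ℝ] V →L[ℝ] ℝ := ε • toDual (ContinuousLinearMap.id ℝ V) + toDual j
  have hB : ∀ x y, B x y = ε * inner ℝ x y + inner ℝ (j x) (j y) := fun x y => rfl
  have hco : IsCoercive B := ⟨ε, hε, fun x => by
    rw [hB, real_inner_self_eq_norm_sq, real_inner_self_eq_norm_sq]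
    nlinarith [sq_nonneg ‖j x‖]⟩
  refine ⟨hco.continuousLinearEquivOfBilin.symm, fun x => ?_⟩
  set y := hco.continuousLinearEquivOfBilin.symm x with hy
  have hx : hco.continuousLinearEquivOfBilin y = x := by simp [hy]
  refine ext_inner_right ℝ fun z => ?_
  rw [inner_add_left, inner_smul_left, inner_gram]
  conv_rhs => rw [← hx, hco.continuousLinearEquivOfBilin_apply]
  exact (hB y z).symm

lemma norm_resolvent_gram_le {j : V →L[ℝ] H} {ε : ℝ} (hε : 0 < ε) {R : V →L[ℝ] V}
    (hR : ∀ x, ε • R x + gram j (R x) = x) (v : V) : ‖R (gram j v)‖ ≤ ‖v‖ := by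
  set x := R (gram j v) with hx
  have h1 : gram j (v - x) = ε • x := by
    rw [map_sub, ← hR (gram j v), ← hx, add_sub_cancel_right]
  have h2 : 0 ≤ ε * inner ℝ x (v - x) := by
    have : inner ℝ (gram j (v - x)) (v - x) = ε * inner ℝ x (v - x) := by
      rw [h1, inner_smul_left]
      rfl
    rw [← this, inner_gram, real_inner_self_eq_norm_sq]
    positivity
  have h3 : 0 ≤ inner ℝ x (v - x) := nonneg_of_mul_nonneg_right h2 hε
  rw [inner_sub_right, real_inner_self_eq_norm_sq] at h3
  have h4 := real_inner_le_norm x v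
  by_contra hcon
  nlinarith [norm_nonneg x, norm_nonneg v]

lemma gram_resolvent_comm {j : V →L[ℝ] H} {ε : ℝ} (hε : 0 < ε) {R : V →L[ℝ] V}
    (hR : ∀ x, ε • R x + gram j (R x) = x) (v : V) : gram j (R v) = R (gram j v) := by
  refine gram_add_smul_injective j hε ?_
  rw [hR, ← map_smul, ← map_add, hR]

lemma denseRange_gram {j : V →L[ℝ] H} (hj : Function.Injective j) : DenseRange (gram j) := by
  have h : (LinearMap.range (gram j : V →ₗ[ℝ] V))ᗮ = ⊥ := by
    rw [Submodule.eq_bot_iff]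
    intro y hy
    have := (Submodule.mem_orthogonal _ _).1 hy (gram j y) ⟨y, rfl⟩
    rw [inner_gram, real_inner_self_eq_norm_sq] at this
    have hjy : j y = 0 := norm_eq_zero.1 (pow_eq_zero_iff two_ne_zero |>.1 this)
    exact hj (hjy.trans (map_zero j).symm)
  have := Submodule.topologicalClosure_eq_top_iff.2 h
  rw [DenseRange, dense_iff_closure_eq]
  have h' := congrArg (fun S : Submodule ℝ V => (S : Set V)) this
  exact h'

/-- The contractions `R n ∘ gram j`, with `R n = ((n + 1)⁻¹ + gram j)⁻¹`, converge strongly to the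
identity. -/
lemma exists_regularization {j : V →L[ℝ] H} (hj : Function.Injective j) :
    ∃ R : ℕ → V →L[ℝ] V, (∀ n v, ‖R n (gram j v)‖ ≤ ‖v‖) ∧
      (∀ n v, gram j (R n v) = R n (gram j v)) ∧
      ∀ v, Tendsto (fun n => R n (gram j v)) atTop (𝓝 v) := by
  have hε : ∀ n : ℕ, (0 : ℝ) < 1 / ((n : ℝ) + 1) := fun n => Nat.one_div_pos_of_nat
  choose R hR using fun n => exists_resolvent j (hε n)
  have hn := fun n => norm_resolvent_gram_le (hε n) (hR n)
  have hc := fun n => gram_resolvent_comm (hε n) (hR n)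
  refine ⟨R, hn, hc, fun v => ?_⟩
  have key : ∀ z n, ‖R n (gram j v) - v‖ ≤ 2 * ‖v - gram j z‖ + 1 / ((n : ℝ) + 1) * ‖z‖ := by
    intro z n
    have e1 : R n (gram j (gram j z)) - gram j z = -((1 / ((n : ℝ) + 1)) • R n (gram j z)) := by
      rw [← hc n (gram j z), sub_eq_iff_eq_add, neg_add_eq_sub, eq_sub_iff_add_eq, add_comm]
      exact hR n _
    have e2 : R n (gram j v) - v = R n (gram j (v - gram j z)) - (v - gram j z) +
        (R n (gram j (gram j z)) - gram j z) := by
      rw [map_sub, map_sub]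
      abel
    rw [e2, e1]
    refine (norm_add_le _ _).trans (add_le_add ?_ ?_)
    · refine (norm_sub_le _ _).trans ?_
      linarith [hn n (v - gram j z)]
    · rw [norm_neg, norm_smul, Real.norm_of_nonneg (hε n).le]
      exact mul_le_mul_of_nonneg_left (hn n z) (hε n).le
  rw [Metric.tendsto_atTop]
  intro δ hδ
  obtain ⟨z, hz⟩ := (denseRange_gram hj).exists_dist_lt v (show 0 < δ / 4 by positivity)
  rw [dist_eq_norm] at hz
  have hlim : Tendsto (fun n : ℕ => 1 / ((n : ℝ) + 1) * ‖z‖) atTop (𝓝 0) := by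
    simpa using (tendsto_one_div_add_atTop_nhds_zero_nat (𝕜 := ℝ)).mul_const ‖z‖
  obtain ⟨N, hN⟩ := (Metric.tendsto_atTop.1 hlim) (δ / 4) (by positivity)
  refine ⟨N, fun n hn' => ?_⟩
  have h1 := hN n hn'
  rw [Real.dist_eq, sub_zero] at h1
  have h2 := le_abs_self (1 / ((n : ℝ) + 1) * ‖z‖)
  rw [dist_eq_norm]
  linarith [key z n]

lemma norm_sq_L2T {E : Type} [NormedAddCommGroup E] [InnerProductSpace ℝ E] (w : L2T T E) :
    ‖w‖ ^ 2 = ∫ t, ‖w t‖ ^ 2 ∂(vol 0 T) := by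
  rw [← real_inner_self_eq_norm_sq, L2.inner_def]
  simp_rw [real_inner_self_eq_norm_sq]

lemma integrable_norm_sq_L2T {E : Type} [NormedAddCommGroup E] (w : L2T T E) :
    Integrable (fun t => ‖w t‖ ^ 2) (vol 0 T) :=
  (memLp_two_iff_integrable_sq_norm (Lp.memLp w).1).1 (Lp.memLp w)

/-- Contractions that converge strongly to the identity do so on `L²` as well. -/
lemma tendsto_compLpL {P : ℕ → V →L[ℝ] V} (hP : ∀ n v, ‖P n v‖ ≤ ‖v‖)
    (hlim : ∀ v, Tendsto (fun n => P n v) atTop (𝓝 v)) (w : L2T T V) :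
    Tendsto (fun n => (P n).compLpL 2 (vol 0 T) w) atTop (𝓝 w) := by
  rw [tendsto_iff_norm_sub_tendsto_zero]
  have h2 : Tendsto (fun n => ‖(P n).compLpL 2 (vol 0 T) w - w‖ ^ 2) atTop (𝓝 0) := by
    have e : ∀ n, ‖(P n).compLpL 2 (vol 0 T) w - w‖ ^ 2 =
        ∫ t, ‖P n (w t) - w t‖ ^ 2 ∂(vol 0 T) := by
      intro n
      rw [norm_sq_L2T]
      refine integral_congr_ae ?_
      filter_upwards [Lp.coeFn_sub ((P n).compLpL 2 (vol 0 T) w) w,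
        (P n).coeFn_compLpL (p := 2) (μ := vol 0 T) w] with t h1 h2
      rw [h1, Pi.sub_apply, h2]
    simp_rw [e]
    have hdom := tendsto_integral_of_dominated_convergence (μ := vol 0 T)
      (F := fun n t => ‖P n (w t) - w t‖ ^ 2) (f := fun _ => (0 : ℝ)) (fun t => 4 * ‖w t‖ ^ 2)
      (fun n => ((((P n).continuous.comp_aestronglyMeasurable (Lp.memLp w).1).sub
        (Lp.memLp w).1).norm.pow 2)) ((integrable_norm_sq_L2T w).const_mul 4)
      (fun n => Eventually.of_forall fun t => ?_) (Eventually.of_forall fun t => ?_)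
    · simpa using hdom
    · have h1 : ‖P n (w t) - w t‖ ≤ 2 * ‖w t‖ :=
        (norm_sub_le _ _).trans (by linarith [hP n (w t)])
      rw [Real.norm_of_nonneg (by positivity)]
      nlinarith [norm_nonneg (P n (w t) - w t)]
    · have h1 : Tendsto (fun n => P n (w t) - w t) atTop (𝓝 0) := by
        simpa using (hlim (w t)).sub_const (w t)
      simpa using h1.norm.pow 2
  have h3 := (Real.continuous_sqrt.tendsto 0).comp h2
  simpa [Function.comp_def, Real.sqrt_sq] using h3

/-- The embedding estimate of the evolution space into the continuous functions, for a function `D`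
that is a primitive in `𝕍`. It is obtained from the energy identity between `s` and `t` by
averaging over `s`. -/
lemma norm_sq_primitive_le (hT : 0 < T) (j : V →L[ℝ] H) (c : V) (g D q : L2T T V)
    (hD : D =ᵐ[vol 0 T] fun t => c + ∫ s in 0..t, g s)
    (hq : q =ᵐ[vol 0 T] fun t => gram j (g t)) {t : ℝ} (ht : t ∈ Icc 0 T) :
    ‖j (c + ∫ s in 0..t, g s)‖ ^ 2 ≤ (‖j‖ ^ 2 / T + 2) * (‖D‖ ^ 2 + ‖q‖ ^ 2) := by
  have hg := integrable_L2T g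
  have hi := integrable_inner_primitive hT.le j c hg
  set p : ℝ → ℝ := fun s => inner ℝ (j (g s)) (j (c + ∫ r in 0..s, g r)) with hp
  have hP : ∫ s, ‖p s‖ ∂(vol 0 T) ≤ (‖D‖ ^ 2 + ‖q‖ ^ 2) / 2 := by
    rw [norm_sq_L2T, norm_sq_L2T, ← integral_add (integrable_norm_sq_L2T D)
      (integrable_norm_sq_L2T q), ← integral_div]
    refine integral_mono_ae hi.norm
      (((integrable_norm_sq_L2T D).add (integrable_norm_sq_L2T q)).div_const 2) ?_
    filter_upwards [hD, hq] with s h1 h2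
    have : p s = inner ℝ (q s) (D s) := by rw [h2, inner_gram, h1]
    rw [this]
    have := norm_inner_le_norm (𝕜 := ℝ) (q s) (D s)
    nlinarith [sq_nonneg (‖q s‖ - ‖D s‖)]
  have hstep : ∀ s ∈ Icc 0 T, ‖j (c + ∫ r in 0..t, g r)‖ ^ 2 ≤
      ‖j (c + ∫ r in 0..s, g r)‖ ^ 2 + 2 * (‖D‖ ^ 2 + ‖q‖ ^ 2) := by
    intro s hs
    have h1 := norm_primitive_le hi ht
    have h2 := norm_primitive_le hi hs
    rw [Real.norm_eq_abs, abs_le] at h1 h2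
    rw [norm_sq_primitive j c hg ht, norm_sq_primitive j c hg hs]
    linarith [h1.2, h2.1]
  have hint : ∫ _s, ‖j (c + ∫ r in 0..t, g r)‖ ^ 2 ∂(vol 0 T) ≤
      ∫ s, (‖j‖ ^ 2 * ‖D s‖ ^ 2 + 2 * (‖D‖ ^ 2 + ‖q‖ ^ 2)) ∂(vol 0 T) := by
    refine integral_mono_ae (integrable_const _)
      (((integrable_norm_sq_L2T D).const_mul _).add (integrable_const _)) ?_
    filter_upwards [hD, ae_restrict_mem measurableSet_Ioo] with s h1 h2
    refine (hstep s (Ioo_subset_Icc_self h2)).trans ?_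
    rw [← h1]
    have := pow_le_pow_left₀ (norm_nonneg _) (j.le_opNorm (D s)) 2
    rw [mul_pow] at this
    linarith
  rw [integral_add ((integrable_norm_sq_L2T D).const_mul _) (integrable_const _),
    integral_const_mul, ← norm_sq_L2T] at hint
  simp only [integral_const, smul_eq_mul] at hint
  have hv : (vol 0 T).real univ = T := by simp [hT.le]
  rw [hv] at hint
  have h3 : ‖j‖ ^ 2 / T * T = ‖j‖ ^ 2 := by field_simp
  have h4 : T * ‖j (c + ∫ s in 0..t, g s)‖ ^ 2 ≤
      T * ((‖j‖ ^ 2 / T + 2) * (‖D‖ ^ 2 + ‖q‖ ^ 2)) := by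
    calc _ ≤ _ := hint
      _ ≤ ‖j‖ ^ 2 * (‖D‖ ^ 2 + ‖q‖ ^ 2) + T * (2 * (‖D‖ ^ 2 + ‖q‖ ^ 2)) := by
        gcongr
        nlinarith [sq_nonneg ‖q‖]
      _ = (‖j‖ ^ 2 / T * T) * (‖D‖ ^ 2 + ‖q‖ ^ 2) + T * (2 * (‖D‖ ^ 2 + ‖q‖ ^ 2)) := by rw [h3]
      _ = _ := by ring
  exact le_of_mul_le_mul_left h4 hT

/-- **The continuous representative and the energy identity.** If `(j† j w)' = g` in
`L²(0, T; 𝕍)`, then `j w` has a representative `r` in `C([0, T]; ℍ)`, and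
`‖r(t)‖² = ‖r(0)‖² + 2 ∫₀ᵗ (g, w)`. The functions `R n (gram j (w t))` are primitives in `𝕍`, for which
this is the classical product rule, and the identity passes to the limit. -/
theorem exists_continuousRep_and_energy (hT : 0 < T) {j : V →L[ℝ] H} (hj : Function.Injective j)
    (w g : L2T T V) (c : V) (h : ∀ᵐ t ∂(vol 0 T), gram j (w t) = c + ∫ s in 0..t, g s) :
    ∃ r : C(Icc (0 : ℝ) T, H), (∀ᵐ t ∂(vol 0 T), ∀ ht : t ∈ Icc (0 : ℝ) T, r ⟨t, ht⟩ = j (w t)) ∧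
      (∀ t (ht : t ∈ Icc (0 : ℝ) T),
        ContinuousLinearMap.adjoint j (r ⟨t, ht⟩) = c + ∫ s in 0..t, g s) ∧
      ∀ t (ht : t ∈ Icc (0 : ℝ) T), ‖r ⟨t, ht⟩‖ ^ 2 =
        ‖r ⟨0, left_mem_Icc.2 hT.le⟩‖ ^ 2 + 2 * ∫ s in 0..t, inner ℝ (g s) (w s) := by
  obtain ⟨R, hRn, hRc, hRl⟩ := exists_regularization hj
  have hg := integrable_L2T g
  let Γ : ℝ → V := fun t => c + ∫ s in 0..t, g s
  have hΓ : ContinuousOn Γ (Icc 0 T) := continuousOn_const.add (continuousOn_primitive hT.le hg)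
  have hD : ∀ n, ∀ t ∈ Icc 0 T, R n (Γ t) = R n c + ∫ s in 0..t, R n (g s) := by
    intro n t ht
    rw [map_add, ContinuousLinearMap.intervalIntegral_comp_comm]
    exact intervalIntegrable_of_integrable_vol ht.1 (integrable_vol_mono le_rfl ht.2 hg)
  let P : ℕ → V →L[ℝ] V := fun n => R n ∘L gram j
  have hPw := tendsto_compLpL (T := T) (P := P) hRn hRl w
  have hPg := tendsto_compLpL (T := T) (P := P) hRn hRl g
  let r : ℕ → C(Icc (0 : ℝ) T, H) := fun n =>
    ⟨fun t => j (R n (Γ t)), (j.continuous.comp (R n).continuous).comp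
      (continuousOn_iff_continuous_domRestrict.1 hΓ)⟩
  set κ : ℝ := ‖j‖ ^ 2 / T + 2 with hκ
  have hκ0 : 0 ≤ κ := by positivity
  have hdist : ∀ n m, dist (r n) (r m) ≤ Real.sqrt κ *
      (dist ((P n).compLpL 2 (vol 0 T) w) ((P m).compLpL 2 (vol 0 T) w) +
       dist ((P n).compLpL 2 (vol 0 T) g) ((P m).compLpL 2 (vol 0 T) g)) := by
    intro n m
    rw [dist_eq_norm, dist_eq_norm, dist_eq_norm, ContinuousMap.norm_le _ (by positivity)]
    rintro ⟨t, ht⟩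
    have hgn : Integrable (fun s => R n (g s)) (vol 0 T) := (R n).integrable_comp hg
    have hgm : Integrable (fun s => R m (g s)) (vol 0 T) := (R m).integrable_comp hg
    have hdiff : ∀ t ∈ Icc 0 T, R n (Γ t) - R m (Γ t) =
        (R n c - R m c) + ∫ s in 0..t, ((R n - R m).compLpL 2 (vol 0 T) g) s := by
      intro t ht
      rw [primitive_congr ((R n - R m).coeFn_compLpL g) ht]
      simp only [sub_apply]
      rw [intervalIntegral.integral_sub
        (intervalIntegrable_of_integrable_vol ht.1 (integrable_vol_mono le_rfl ht.2 hgn))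
        (intervalIntegrable_of_integrable_vol ht.1 (integrable_vol_mono le_rfl ht.2 hgm)),
        hD n t ht, hD m t ht]
      abel
    have h1 := norm_sq_primitive_le hT j (R n c - R m c) ((R n - R m).compLpL 2 (vol 0 T) g)
      ((P n).compLpL 2 (vol 0 T) w - (P m).compLpL 2 (vol 0 T) w)
      ((P n).compLpL 2 (vol 0 T) g - (P m).compLpL 2 (vol 0 T) g) ?_ ?_ ht
    · rw [← hdiff t ht, map_sub] at h1
      change ‖j (R n (Γ t)) - j (R m (Γ t))‖ ≤ _
      set A := ‖(P n).compLpL 2 (vol 0 T) w - (P m).compLpL 2 (vol 0 T) w‖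
      set B := ‖(P n).compLpL 2 (vol 0 T) g - (P m).compLpL 2 (vol 0 T) g‖
      have hA : 0 ≤ A := norm_nonneg _
      have hB : 0 ≤ B := norm_nonneg _
      refine abs_le_of_sq_le_sq' ?_ (by positivity) |>.2
      rw [mul_pow, Real.sq_sqrt hκ0]
      refine h1.trans (mul_le_mul_of_nonneg_left ?_ hκ0)
      nlinarith [mul_nonneg hA hB]
    · filter_upwards [Lp.coeFn_sub ((P n).compLpL 2 (vol 0 T) w) ((P m).compLpL 2 (vol 0 T) w),
        (P n).coeFn_compLpL (p := 2) (μ := vol 0 T) w,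
        (P m).coeFn_compLpL (p := 2) (μ := vol 0 T) w, h, ae_restrict_mem measurableSet_Ioo]
        with s e1 e2 e3 e4 e5
      rw [e1, Pi.sub_apply, e2, e3, ← hdiff s (Ioo_subset_Icc_self e5)]
      simp only [P, ContinuousLinearMap.comp_apply, e4, Γ]
    · filter_upwards [Lp.coeFn_sub ((P n).compLpL 2 (vol 0 T) g) ((P m).compLpL 2 (vol 0 T) g),
        (P n).coeFn_compLpL (p := 2) (μ := vol 0 T) g,
        (P m).coeFn_compLpL (p := 2) (μ := vol 0 T) g,
        (R n - R m).coeFn_compLpL (p := 2) (μ := vol 0 T) g] with s e1 e2 e3 e4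
      rw [e1, Pi.sub_apply, e2, e3, e4, sub_apply, map_sub, hRc, hRc]
      rfl
  have hcauchy : CauchySeq r := by
    rw [cauchySeq_iff_tendsto_dist_atTop_0]
    have h1 := cauchySeq_iff_tendsto_dist_atTop_0.1 hPw.cauchySeq
    have h2 := cauchySeq_iff_tendsto_dist_atTop_0.1 hPg.cauchySeq
    refine squeeze_zero (fun _ => dist_nonneg) (fun p => hdist p.1 p.2) ?_
    simpa using (h1.add h2).const_mul (Real.sqrt κ)
  obtain ⟨ρ, hρ⟩ := cauchySeq_tendsto_of_complete hcauchy
  have hpt : ∀ t : Icc (0 : ℝ) T, Tendsto (fun n => j (R n (Γ t))) atTop (𝓝 (ρ t)) := fun t =>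
    ((ContinuousEvalConst.continuous_eval_const t).tendsto ρ).comp hρ
  refine ⟨ρ, ?_, fun t ht => ?_, fun t ht => ?_⟩
  · filter_upwards [h] with t h1 ht
    have h2 := hpt ⟨t, ht⟩
    simp only [Γ, ← h1] at h2
    exact tendsto_nhds_unique h2 ((j.continuous.tendsto _).comp (hRl (w t)))
  · have h1 := ((ContinuousLinearMap.adjoint j).continuous.tendsto _).comp (hpt ⟨t, ht⟩)
    have h2 : (ContinuousLinearMap.adjoint j ∘ fun n => j (R n (Γ t))) =
        fun n => R n (gram j (Γ t)) := by
      funext n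
      rw [← hRc]
      rfl
    rw [h2] at h1
    exact tendsto_nhds_unique h1 (hRl (Γ t))
  · have h0 : Γ 0 = c := by simp [Γ]
    have hn : ∀ n, ‖j (R n (Γ t))‖ ^ 2 = ‖j (R n (Γ 0))‖ ^ 2 +
        2 * ∫ s, inner ℝ (R n (gram j (g s))) (R n (gram j (w s))) ∂(vol 0 t) := by
      intro n
      have hgn : Integrable (fun s => R n (g s)) (vol 0 T) := (R n).integrable_comp hg
      rw [hD n t ht, norm_sq_primitive j (R n c) hgn ht, h0, intervalIntegral_eq_integral_vol ht.1]
      congr 2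
      refine integral_congr_ae ?_
      filter_upwards [ae_mono (Measure.restrict_mono (Ioo_subset_Ioo le_rfl ht.2) le_rfl) h,
        ae_restrict_mem measurableSet_Ioo] with s h1 h2
      rw [← hD n s ⟨h2.1.le, h2.2.le.trans ht.2⟩, ← inner_gram, hRc, h1]
    have hlim : Tendsto (fun n => ∫ s, inner ℝ (R n (gram j (g s))) (R n (gram j (w s)))
        ∂(vol 0 t)) atTop (𝓝 (∫ s, inner ℝ (g s) (w s) ∂(vol 0 t))) := by
      have hmono : vol 0 t ≤ vol 0 T :=
        Measure.restrict_mono (Ioo_subset_Ioo le_rfl ht.2) le_rfl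
      have hgm : AEStronglyMeasurable g (vol 0 t) := (Lp.memLp g).1.mono_measure hmono
      have hwm : AEStronglyMeasurable w (vol 0 t) := (Lp.memLp w).1.mono_measure hmono
      refine tendsto_integral_of_dominated_convergence (fun s => ‖g s‖ ^ 2 + ‖w s‖ ^ 2)
        (fun n => ?_) ?_ (fun n => Eventually.of_forall fun s => ?_)
        (Eventually.of_forall fun s => (hRl (g s)).inner (hRl (w s)))
      · exact ((P n).continuous.comp_aestronglyMeasurable hgm).inner
          ((P n).continuous.comp_aestronglyMeasurable hwm)
      · exact ((integrable_norm_sq_L2T g).add (integrable_norm_sq_L2T w)).mono_measure hmono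
      · refine (norm_inner_le_norm _ _).trans ?_
        have h1 := hRn n (g s)
        have h2 := hRn n (w s)
        have := mul_le_mul h1 h2 (norm_nonneg _) (norm_nonneg _)
        nlinarith [sq_nonneg (‖g s‖ - ‖w s‖), sq_nonneg ‖g s‖, sq_nonneg ‖w s‖]
    have e1 := (hpt ⟨t, ht⟩).norm.pow 2
    have e2 := ((hpt ⟨0, left_mem_Icc.2 hT.le⟩).norm.pow 2).add (hlim.const_mul 2)
    simp only [hn] at e1
    rw [intervalIntegral_eq_integral_vol ht.1]
    exact tendsto_nhds_unique e1 e2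

end Energy

/-! ### Well-posedness of the abstract evolution equation -/

section Gronwall

/-- Grönwall's inequality in integral form. -/
lemma le_exp_of_le_add_integral {e : ℝ → ℝ} (he : Continuous e) {T E0 L : ℝ} (hL : 0 ≤ L)
    (h : ∀ t ∈ Icc 0 T, e t ≤ E0 + L * ∫ s in 0..t, e s) {t : ℝ} (ht : t ∈ Icc 0 T) :
    e t ≤ E0 * Real.exp (L * t) := by
  let y : ℝ → ℝ := fun t => (E0 + L * ∫ s in 0..t, e s) * Real.exp (-(L * t))
  have hy : ∀ t, HasDerivAt y (L * e t * Real.exp (-(L * t)) +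
      (E0 + L * ∫ s in 0..t, e s) * (Real.exp (-(L * t)) * -L)) t := by
    intro t
    refine (((he.integral_hasStrictDerivAt 0 t).hasDerivAt.const_mul L).const_add E0).mul ?_
    simpa using (((hasDerivAt_id t).const_mul L).neg).exp
  have hanti : AntitoneOn y (Icc 0 T) := by
    refine antitoneOn_of_deriv_nonpos (convex_Icc 0 T)
      (fun t _ => (hy t).continuousAt.continuousWithinAt)
      (fun t _ => (hy t).differentiableAt.differentiableWithinAt) fun t ht => ?_
    rw [(hy t).deriv]
    have h1 := h t (interior_subset ht)
    have h2 := mul_nonneg hL (Real.exp_pos (-(L * t))).le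
    nlinarith [mul_nonneg h2 (sub_nonneg.2 h1)]
  have h1 := hanti (left_mem_Icc.2 (ht.1.trans ht.2)) ht ht.1
  have h2 : y 0 = E0 := by simp [y]
  rw [h2] at h1
  calc e t ≤ E0 + L * ∫ s in 0..t, e s := h t ht
    _ = y t * Real.exp (L * t) := by
      simp only [y]
      rw [mul_assoc, ← Real.exp_add, neg_add_cancel, Real.exp_zero, mul_one]
    _ ≤ E0 * Real.exp (L * t) := mul_le_mul_of_nonneg_right h1 (Real.exp_pos _).le

end Gronwall

section WeakDerivClm

variable {E F : Type*} [NormedAddCommGroup E] [NormedSpace ℝ E] [CompleteSpace E]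
  [NormedAddCommGroup F] [NormedSpace ℝ F] [CompleteSpace F] {a b : ℝ}

lemma IsWeakDeriv.clm_comp {f g : ℝ → E} (h : IsWeakDeriv a b f g) (L : E →L[ℝ] F)
    (hf : Integrable f (vol a b)) (hg : Integrable g (vol a b)) :
    IsWeakDeriv a b (fun t => L (f t)) fun t => L (g t) := by
  intro ψ
  simp only [← map_smul]
  rw [L.integral_comp_comm (integrable_deriv_testFunction_smul' ψ hf),
    L.integral_comp_comm (integrable_testFunction_smul' ψ hg), h ψ, map_neg]

lemma IsWeakDeriv.unique {f g g' : ℝ → E} (h : IsWeakDeriv a b f g) (h' : IsWeakDeriv a b f g')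
    (hg : Integrable g (vol a b)) (hg' : Integrable g' (vol a b)) : g =ᵐ[vol a b] g' := by
  have := ae_eq_zero_of_integral_testFunction (hg.sub hg') fun ψ => by
    simp only [Pi.sub_apply, smul_sub]
    rw [integral_sub (integrable_testFunction_smul' ψ hg) (integrable_testFunction_smul' ψ hg'),
      ← neg_inj, neg_sub, sub_eq_neg_add, neg_add_eq_sub, neg_zero]
    have h1 := h ψ
    have h2 := h' ψ
    rw [h1, neg_inj] at h2
    rw [h2, sub_self]
  filter_upwards [this] with t ht
  exact sub_eq_zero.1 ht

end WeakDerivClm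

section WellPosed

variable {V H : Type} [NormedAddCommGroup V] [InnerProductSpace ℝ V] [CompleteSpace V]
  [NormedAddCommGroup H] [InnerProductSpace ℝ H] [CompleteSpace H] {T : ℝ}

lemma continuousMap_eq_of_ae_eq (hT : 0 < T) {r r' : C(Icc (0 : ℝ) T, H)}
    (h : ∀ᵐ t ∂(vol 0 T), ∀ ht : t ∈ Icc (0 : ℝ) T, r ⟨t, ht⟩ = r' ⟨t, ht⟩) : r = r' := by
  have h1 : EqOn (IccExtend hT.le r) (IccExtend hT.le r') (Icc 0 T) := by
    refine Measure.eqOn_Icc_of_ae_eq volume hT.ne ?_ (r.continuous.Icc_extend' ).continuousOn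
      (r'.continuous.Icc_extend').continuousOn
    rw [← Measure.restrict_congr_set (Ioo_ae_eq_Icc (μ := volume) (a := (0 : ℝ)) (b := T))]
    filter_upwards [h, ae_restrict_mem measurableSet_Ioo] with t h1 h2
    rw [IccExtend_of_mem _ _ (Ioo_subset_Icc_self h2), IccExtend_of_mem _ _ (Ioo_subset_Icc_self h2)]
    exact h1 _
  ext ⟨t, ht⟩
  have := h1 ht
  rwa [IccExtend_of_mem _ _ ht, IccExtend_of_mem _ _ ht] at this

/-- The a priori estimates: the energy identity, coercivity up to `λ ‖j ·‖²` and Grönwall's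
inequality. -/
lemma apriori_estimates (hT : 0 < T) {j : V →L[ℝ] H} (hj : Function.Injective j)
    {A : ℝ → V →L[ℝ] V} {Λ α lam : ℝ} (hα : 0 < α) (hlam : 0 ≤ lam)
    (hA : ∀ v, AEStronglyMeasurable (fun t => A t v) (vol 0 T)) (hΛ : ∀ t, ‖A t‖ ≤ Λ)
    (hcoer : ∀ t v, α * ‖v‖ ^ 2 ≤ inner ℝ (A t v) v + lam * ‖j v‖ ^ 2)
    (w : L2T T V) (c : V)
    (h : ∀ᵐ t ∂(vol 0 T), gram j (w t) = c + ∫ s in 0..t, (-pointwise A hA hΛ w : L2T T V) s) :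
    ∃ r : C(Icc (0 : ℝ) T, H), (∀ᵐ t ∂(vol 0 T), ∀ ht : t ∈ Icc (0 : ℝ) T, r ⟨t, ht⟩ = j (w t)) ∧
      ContinuousLinearMap.adjoint j (r ⟨0, left_mem_Icc.2 hT.le⟩) = c ∧
      ‖r‖ ≤ Real.exp (lam * T) * ‖r ⟨0, left_mem_Icc.2 hT.le⟩‖ ∧
      ‖w‖ ≤ Real.sqrt ((1 + 2 * lam * T * Real.exp (2 * lam * T)) / (2 * α)) *
        ‖r ⟨0, left_mem_Icc.2 hT.le⟩‖ := by
  obtain ⟨r, hr, hrc, hre⟩ := exists_continuousRep_and_energy hT hj w _ c h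
  have hgA := coeFn_neg_pointwise A hA hΛ w
  set r0 : H := r ⟨0, left_mem_Icc.2 hT.le⟩ with hr0
  let e : ℝ → ℝ := fun t => ‖IccExtend hT.le r t‖ ^ 2
  have hecont : Continuous e := (r.continuous.Icc_extend').norm.pow 2
  have het : ∀ t (ht : t ∈ Icc 0 T), e t = ‖r ⟨t, ht⟩‖ ^ 2 := fun t ht => by
    simp only [e, IccExtend_of_mem _ _ ht]
  have henergy : ∀ t ∈ Icc 0 T, e t + 2 * α * ∫ s in 0..t, ‖w s‖ ^ 2 ≤
      ‖r0‖ ^ 2 + 2 * lam * ∫ s in 0..t, e s := by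
    intro t ht
    have hmono : vol 0 t ≤ vol 0 T := Measure.restrict_mono (Ioo_subset_Ioo le_rfl ht.2) le_rfl
    have hw := (integrable_norm_sq_L2T w).mono_measure hmono
    have hei : Integrable e (vol 0 t) := integrable_vol_of_continuous hecont
    have hgi : Integrable (fun s => inner ℝ ((-pointwise A hA hΛ w : L2T T V) s) (w s)) (vol 0 t) :=
      (L2.integrable_inner (𝕜 := ℝ) _ _).mono_measure hmono
    rw [het t ht, hre t ht, intervalIntegral_eq_integral_vol ht.1,
      intervalIntegral_eq_integral_vol ht.1, intervalIntegral_eq_integral_vol ht.1]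
    have : α * ∫ s, ‖w s‖ ^ 2 ∂(vol 0 t) +
        ∫ s, inner ℝ ((-pointwise A hA hΛ w : L2T T V) s) (w s) ∂(vol 0 t) ≤
        lam * ∫ s, e s ∂(vol 0 t) := by
      rw [← integral_const_mul, ← integral_const_mul, ← integral_add (hw.const_mul α) hgi]
      refine integral_mono_ae ((hw.const_mul α).add hgi) (hei.const_mul lam) ?_
      filter_upwards [ae_mono hmono hgA, ae_mono hmono hr, ae_restrict_mem measurableSet_Ioo]
        with s h1 h2 h3
      have h4 : s ∈ Icc 0 T := ⟨h3.1.le, h3.2.le.trans ht.2⟩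
      rw [h1, het s h4, h2 h4, inner_neg_left]
      linarith [hcoer s (w s)]
    linarith
  have hw0 : ∀ t ∈ Icc 0 T, 0 ≤ ∫ s in 0..t, ‖w s‖ ^ 2 := fun t ht =>
    intervalIntegral.integral_nonneg ht.1 fun _ _ => by positivity
  have hgron : ∀ t ∈ Icc 0 T, e t ≤ ‖r0‖ ^ 2 * Real.exp (2 * lam * t) := fun t ht =>
    le_exp_of_le_add_integral hecont (by positivity) (fun s hs => by
      have := henergy s hs
      have := mul_nonneg (mul_nonneg zero_le_two hα.le) (hw0 s hs)
      linarith) ht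
  have hgronT : ∀ t ∈ Icc 0 T, e t ≤ ‖r0‖ ^ 2 * Real.exp (2 * lam * T) := fun t ht =>
    (hgron t ht).trans (mul_le_mul_of_nonneg_left (Real.exp_le_exp.2
      (mul_le_mul_of_nonneg_left ht.2 (by positivity))) (by positivity))
  refine ⟨r, hr, ?_, ?_, ?_⟩
  · rw [hrc 0 (left_mem_Icc.2 hT.le)]
    simp
  · rw [ContinuousMap.norm_le _ (by positivity)]
    rintro ⟨t, ht⟩
    refine abs_le_of_sq_le_sq' ?_ (by positivity) |>.2
    rw [← het t ht, mul_pow, ← Real.exp_nat_mul, mul_comm]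
    refine (hgronT t ht).trans (le_of_eq ?_)
    congr 2
    push_cast
    ring
  · refine abs_le_of_sq_le_sq' ?_ (by positivity) |>.2
    have hTm : T ∈ Icc 0 T := right_mem_Icc.2 hT.le
    have h1 := henergy T hTm
    have h2 : ∫ s in 0..T, e s ≤ T * (‖r0‖ ^ 2 * Real.exp (2 * lam * T)) := by
      have := intervalIntegral.integral_mono_on hT.le (hecont.intervalIntegrable (μ := volume) 0 T)
        (intervalIntegrable_const (c := ‖r0‖ ^ 2 * Real.exp (2 * lam * T))) hgronT
      rwa [intervalIntegral.integral_const, sub_zero, smul_eq_mul] at this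
    have h3 : 0 ≤ e T := by positivity
    rw [mul_pow, Real.sq_sqrt (by positivity), div_mul_eq_mul_div, le_div_iff₀ (by positivity),
      norm_sq_L2T, ← intervalIntegral_eq_integral_vol hT.le (fun s => ‖w s‖ ^ 2)]
    have h4 := mul_le_mul_of_nonneg_left h2 (mul_nonneg zero_le_two hlam)
    linarith

/-- `ρ` is a weak solution of `d/dt (j ρ, j φ) + (A ρ, φ) = 0`, `ρ(0) = ρ0`. -/
def SolvesEvolution (hT : 0 ≤ T) (j : V →L[ℝ] H) (A : ℝ → V →L[ℝ] V) (ρ0 : H)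
    (ρ : EvolutionSpace j T) : Prop :=
  (∀ v : V, ∀ ψ : 𝓓(interval 0 T, ℝ),
    - (∫ t, deriv ψ t * inner ℝ (j (EvolutionSpace.toL2T ρ t)) (j v) ∂(vol 0 T))
      + ∫ t, ψ t * inner ℝ (A t (EvolutionSpace.toL2T ρ t)) v ∂(vol 0 T) = 0) ∧
  ∃ r : C(Icc (0 : ℝ) T, H), IsTimeContRep ρ r ∧ r ⟨0, left_mem_Icc.2 hT⟩ = ρ0

/-- The scalar weak equations, one for each `v`, amount to one equation in `𝕍`. -/
lemma weakDeriv_gram_iff (j : V →L[ℝ] H) {A : ℝ → V →L[ℝ] V} {Λ : ℝ}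
    (hA : ∀ v, AEStronglyMeasurable (fun t => A t v) (vol 0 T)) (hΛ : ∀ t, ‖A t‖ ≤ Λ)
    (w : L2T T V) :
    IsWeakDeriv 0 T (fun t => gram j (w t)) (-pointwise A hA hΛ w : L2T T V) ↔
    ∀ v : V, ∀ ψ : 𝓓(interval 0 T, ℝ), - (∫ t, deriv ψ t * inner ℝ (j (w t)) (j v) ∂(vol 0 T))
      + ∫ t, ψ t * inner ℝ (A t (w t)) v ∂(vol 0 T) = 0 := by
  have hf : Integrable (fun t => gram j (w t)) (vol 0 T) :=
    (gram j).integrable_comp (integrable_L2T w)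
  have hg := integrable_L2T (-pointwise A hA hΛ w : L2T T V)
  have hgA := coeFn_neg_pointwise A hA hΛ w
  have e1 : ∀ (v : V) (ψ : 𝓓(interval 0 T, ℝ)),
      inner ℝ (∫ t, deriv ψ t • gram j (w t) ∂(vol 0 T)) v =
        ∫ t, deriv ψ t * inner ℝ (j (w t)) (j v) ∂(vol 0 T) := by
    intro v ψ
    have := ((toDual (ContinuousLinearMap.id ℝ V)).flip v).integral_comp_comm
      (integrable_deriv_testFunction_smul' ψ hf)
    simp only [ContinuousLinearMap.flip_apply, toDual_apply, ContinuousLinearMap.id_apply] at this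
    rw [← this]
    refine integral_congr_ae (Filter.Eventually.of_forall fun t => ?_)
    dsimp only
    rw [inner_smul_left, inner_gram]
    rfl
  have e2 : ∀ (v : V) (ψ : 𝓓(interval 0 T, ℝ)),
      inner ℝ (-∫ t, ψ t • (-pointwise A hA hΛ w : L2T T V) t ∂(vol 0 T)) v =
        ∫ t, ψ t * inner ℝ (A t (w t)) v ∂(vol 0 T) := by
    intro v ψ
    have := ((toDual (ContinuousLinearMap.id ℝ V)).flip v).integral_comp_comm
      (integrable_testFunction_smul' ψ hg)
    simp only [ContinuousLinearMap.flip_apply, toDual_apply, ContinuousLinearMap.id_apply] at this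
    rw [inner_neg_left, ← this, ← integral_neg]
    refine integral_congr_ae ?_
    filter_upwards [hgA] with t ht
    rw [ht, inner_smul_left, inner_neg_left, mul_neg, neg_neg]
    rfl
  constructor
  · intro h v ψ
    rw [← e1, ← e2, h ψ, neg_add_cancel]
  · intro h ψ
    refine ext_inner_right ℝ fun v => ?_
    rw [e1, e2]
    linarith [h v ψ]

/-- Well-posedness of `d/dt (j ρ, j φ) + (A ρ, φ) = 0` for a bounded, strongly measurable family `A`
that is coercive up to a multiple of `‖j ·‖²`. The hypothesis `hjd` says that the range of `j` is
dense. -/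
theorem existsUnique_solvesEvolution (hT : 0 < T) {j : V →L[ℝ] H} (hj : Function.Injective j)
    (hjd : ∀ h : H, (∀ v, inner ℝ h (j v) = 0) → h = 0)
    {A : ℝ → V →L[ℝ] V} {Λ α lam : ℝ} (hα : 0 < α) (hlam : 0 ≤ lam)
    (hA : ∀ v, AEStronglyMeasurable (fun t => A t v) (vol 0 T)) (hΛ : ∀ t, ‖A t‖ ≤ Λ)
    (hcoer : ∀ t v, α * ‖v‖ ^ 2 ≤ inner ℝ (A t v) v + lam * ‖j v‖ ^ 2) (ρ0 : H) :
    ∃ ρ : EvolutionSpace j T, SolvesEvolution hT.le j A ρ0 ρ ∧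
      (∀ ρ', SolvesEvolution hT.le j A ρ0 ρ' → ρ' = ρ) ∧
      ∃ r : C(Icc (0 : ℝ) T, H), IsTimeContRep ρ r ∧ ‖r‖ ≤ Real.exp (lam * T) * ‖ρ0‖ ∧
        ‖EvolutionSpace.toL2T ρ‖ ≤
          Real.sqrt ((1 + 2 * lam * T * Real.exp (2 * lam * T)) / (2 * α)) * ‖ρ0‖ ∧
        ‖ρ‖ ≤ (1 + Λ) * ‖EvolutionSpace.toL2T ρ‖ := by
  have hΛ0 : 0 ≤ Λ := (norm_nonneg _).trans (hΛ 0)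
  set 𝒜 := pointwise A hA hΛ with h𝒜
  obtain ⟨w, hw⟩ := exists_gram_eq_sub_primitive hT.le j hα hlam hA hΛ hcoer ρ0
  have hw' : ∀ᵐ t ∂(vol 0 T), gram j (w t) =
      ContinuousLinearMap.adjoint j ρ0 + ∫ s in 0..t, (-𝒜 w : L2T T V) s := by
    filter_upwards [hw, ae_restrict_mem measurableSet_Ioo] with t h1 h2
    rw [h1, primitive_congr (coeFn_neg_pointwise A hA hΛ w) (Ioo_subset_Icc_self h2), intervalIntegral.integral_neg,
      sub_eq_add_neg]
  obtain ⟨r, hr, hrc, hrn, hwn⟩ := apriori_estimates hT hj hα hlam hA hΛ hcoer w _ hw'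
  have hr0 : r ⟨0, left_mem_Icc.2 hT.le⟩ = ρ0 := by
    rw [← sub_eq_zero]
    refine hjd _ fun v => ?_
    rw [← ContinuousLinearMap.adjoint_inner_left, map_sub, hrc, sub_self, inner_zero_left]
  have hwd : IsWeakDeriv 0 T (fun t => gram j (w t)) (-𝒜 w : L2T T V) :=
    (IsWeakDeriv.primitive hT.le _ (integrable_L2T _)).congr hw' Filter.EventuallyEq.rfl
  let R : V →L[ℝ] StrongDual ℝ V := toDual (ContinuousLinearMap.id ℝ V)
  have hRn : ‖R‖ ≤ 1 := by
    refine ContinuousLinearMap.opNorm_le_bound _ zero_le_one fun x => ?_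
    rw [one_mul]
    exact ((InnerProductSpace.toDual ℝ V).norm_map x).le
  have hRj : ∀ x, toDual j x = R (gram j x) := fun x => by
    ext y
    rw [toDual_apply, toDual_apply, ContinuousLinearMap.id_apply, ContinuousLinearMap.id_apply,
      inner_gram]
  let q : L2T T (StrongDual ℝ V) := R.compLpL 2 (vol 0 T) (-𝒜 w)
  have hq : ‖q‖ ≤ Λ * ‖w‖ := by
    have h1 : ‖q‖ ≤ ‖R.compLpL 2 (vol 0 T)‖ * ‖-𝒜 w‖ := ContinuousLinearMap.le_opNorm _ _
    have h2 : ‖R.compLpL 2 (vol 0 T)‖ ≤ 1 := (R.norm_compLpL_le).trans hRn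
    rw [norm_neg] at h1
    have h3 : ‖𝒜 w‖ ≤ Λ * ‖w‖ := norm_pointwise_apply_le A hA hΛ w
    exact h1.trans ((mul_le_of_le_one_left (norm_nonneg _) h2).trans h3)
  let ρ : EvolutionSpace j T := ⟨WithLp.toLp 2 (w, q), by
    refine (hwd.clm_comp R ((gram j).integrable_comp (integrable_L2T w))
      (integrable_L2T _)).congr ?_ (R.coeFn_compLpL _)
    exact Filter.Eventually.of_forall fun t => hRj (w t)⟩
  refine ⟨ρ, ⟨(weakDeriv_gram_iff j hA hΛ w).1 hwd, r, hr, hr0⟩, ?_, r, hr, hr0 ▸ hrn,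
    hr0 ▸ hwn, ?_⟩
  · rintro ρ' ⟨hρ', r', hr', hr0'⟩
    have hwd' := (weakDeriv_gram_iff j hA hΛ (EvolutionSpace.toL2T ρ')).2 hρ'
    obtain ⟨c', hc'⟩ := hwd'.exists_ae_eq_primitive hT
      ((gram j).integrable_comp (integrable_L2T _)) (integrable_L2T _)
    -- the difference of two solutions solves the equation with initial value `0`
    have hd : ∀ᵐ t ∂(vol 0 T), gram j ((EvolutionSpace.toL2T ρ' - w : L2T T V) t) =
        (c' - ContinuousLinearMap.adjoint j ρ0) +
          ∫ s in 0..t, (-𝒜 (EvolutionSpace.toL2T ρ' - w) : L2T T V) s := by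
      filter_upwards [hc', hw', Lp.coeFn_sub (EvolutionSpace.toL2T ρ') w,
        ae_restrict_mem measurableSet_Ioo] with t h1 h2 h3 h4
      have h5 : (-𝒜 (EvolutionSpace.toL2T ρ' - w) : L2T T V) =
          -𝒜 (EvolutionSpace.toL2T ρ') - (-𝒜 w) := by
        rw [map_sub]
        abel
      have h6 := Ioo_subset_Icc_self h4
      rw [h3, Pi.sub_apply, map_sub, h1, h2, h5, primitive_congr (Lp.coeFn_sub _ _) h6]
      simp only [Pi.sub_apply]
      rw [intervalIntegral.integral_sub
        (intervalIntegrable_of_integrable_vol h6.1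
          (integrable_vol_mono le_rfl h6.2 (integrable_L2T _)))
        (intervalIntegrable_of_integrable_vol h6.1
          (integrable_vol_mono le_rfl h6.2 (integrable_L2T _)))]
      abel
    obtain ⟨d, hdr, -, -, hdn⟩ := apriori_estimates hT hj hα hlam hA hΛ hcoer _ _ hd
    have hdeq : d = r' - r := by
      refine continuousMap_eq_of_ae_eq hT ?_
      filter_upwards [hdr, hr, hr', Lp.coeFn_sub (EvolutionSpace.toL2T ρ') w] with t h1 h2 h3 h4 ht
      rw [h1 ht, ContinuousMap.sub_apply, h2 ht, h3 ht, h4, Pi.sub_apply, map_sub]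
    rw [hdeq, ContinuousMap.sub_apply, hr0, hr0', sub_self, norm_zero, mul_zero] at hdn
    have hfst : EvolutionSpace.toL2T ρ' = w := sub_eq_zero.1 (norm_le_zero_iff.1 hdn)
    have hsnd : (ρ' : WithLp 2 (L2T T V × L2T T (StrongDual ℝ V))).snd = q := by
      have h1 : IsWeakDeriv 0 T (fun t => toDual j (EvolutionSpace.toL2T ρ' t))
        (ρ' : WithLp 2 (L2T T V × L2T T (StrongDual ℝ V))).snd := ρ'.2
      rw [hfst] at h1
      exact Lp.ext (h1.unique ρ.2 (integrable_L2T _) (integrable_L2T q))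
    refine Subtype.ext ((WithLp.ofLp_injective 2) (Prod.ext hfst hsnd))
  · have h1 : ‖ρ‖ ^ 2 = ‖w‖ ^ 2 + ‖q‖ ^ 2 := WithLp.prod_norm_sq_eq_of_L2 _
    change ‖ρ‖ ≤ (1 + Λ) * ‖w‖
    refine abs_le_of_sq_le_sq' ?_ (by positivity) |>.2
    rw [h1]
    have h2 := pow_le_pow_left₀ (norm_nonneg _) hq 2
    nlinarith [mul_nonneg hΛ0 (sq_nonneg ‖w‖)]

end WellPosed

/-! ### The Hilbert space `𝕍` on the star graph -/

section Sobolev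

variable {l : ℝ}

lemma inner_eq_mul (x y : ℝ) : inner ℝ x y = x * y := by
  rw [RCLike.inner_apply, conj_trivial, mul_comm]

lemma memLp_of_continuous {a b : ℝ} {k : ℝ → ℝ} (hk : Continuous k) : MemLp k 2 (vol a b) := by
  obtain ⟨C, hC⟩ := (isCompact_Icc (a := a) (b := b)).exists_bound_of_continuousOn hk.continuousOn
  exact MemLp.of_bound hk.aestronglyMeasurable C ((ae_restrict_iff' measurableSet_Ioo).2
    (Filter.Eventually.of_forall fun t ht => hC t (Ioo_subset_Icc_self ht)))

lemma continuous_integral_mul {k : ℝ → ℝ} (hk : Continuous k) :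
    Continuous fun f : L2 l => ∫ x, k x * f x ∂(vol 0 l) := by
  have : (fun f : L2 l => ∫ x, k x * f x ∂(vol 0 l)) =
      fun f : L2 l => inner ℝ ((memLp_of_continuous hk).toLp k) f := by
    funext f
    rw [L2.inner_def]
    refine integral_congr_ae ?_
    filter_upwards [(memLp_of_continuous (a := 0) (b := l) hk).coeFn_toLp] with x hx
    rw [hx, inner_eq_mul]
  rw [this]
  exact continuous_const.inner continuous_id

lemma isClosed_H1 : IsClosed (H1 l : Set (WithLp 2 (L2 l × L2 l))) := by
  have : (H1 l : Set (WithLp 2 (L2 l × L2 l))) = ⋂ ψ : 𝓓(interval 0 l, ℝ),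
      {p | ∫ t, deriv ψ t * p.fst t ∂(vol 0 l) = -∫ t, ψ t * p.snd t ∂(vol 0 l)} := by
    ext p
    simp only [mem_iInter, mem_ofPred_eq]
    exact Iff.rfl
  rw [this]
  refine isClosed_iInter fun ψ => isClosed_eq ?_ ?_
  · exact (continuous_integral_mul (continuous_deriv_testFunction ψ)).comp
      (WithLp.fstL 2 ℝ (L2 l) (L2 l)).continuous
  · exact ((continuous_integral_mul ψ.continuous).comp
      (WithLp.sndL 2 ℝ (L2 l) (L2 l)).continuous).neg

instance : CompleteSpace (H1 l) := isClosed_H1.completeSpace_coe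

/-- The value at `0` of the continuous representative of `p ∈ H¹(0, l)`, as an integral that makes
its continuity in `p` visible. -/
def traceZero (p : H1 l) : ℝ :=
  (∫ x, 1 * (p : WithLp 2 (L2 l × L2 l)).fst x ∂(vol 0 l) +
    ∫ x, (-l + x) * (p : WithLp 2 (L2 l × L2 l)).snd x ∂(vol 0 l)) / l

/-- The value at `l` of the continuous representative of `p ∈ H¹(0, l)`. -/
def traceEnd (p : H1 l) : ℝ :=
  (∫ x, 1 * (p : WithLp 2 (L2 l × L2 l)).fst x ∂(vol 0 l) +
    ∫ x, x * (p : WithLp 2 (L2 l × L2 l)).snd x ∂(vol 0 l)) / l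

lemma continuous_traceZero : Continuous (traceZero (l := l)) := by
  refine ((((continuous_integral_mul (k := fun _ => 1) continuous_const).comp
    (WithLp.fstL 2 ℝ (L2 l) (L2 l)).continuous).add ((continuous_integral_mul (k := fun x => -l + x)
    (by fun_prop)).comp (WithLp.sndL 2 ℝ (L2 l) (L2 l)).continuous)).div_const l).comp
    continuous_subtype_val

lemma continuous_traceEnd : Continuous (traceEnd (l := l)) := by
  refine ((((continuous_integral_mul (k := fun _ => 1) continuous_const).comp
    (WithLp.fstL 2 ℝ (L2 l) (L2 l)).continuous).add ((continuous_integral_mul (k := fun x => x)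
    (by fun_prop)).comp (WithLp.sndL 2 ℝ (L2 l) (L2 l)).continuous)).div_const l).comp
    continuous_subtype_val

lemma integrable_L2 (f : L2 l) : Integrable f (vol 0 l) := (Lp.memLp f).integrable one_le_two

lemma exists_continuousOn_H1 (hl : 0 < l) (p : H1 l) : ∃ F : ℝ → ℝ,
    ContinuousOn F (Icc 0 l) ∧ F =ᵐ[vol 0 l] (p : WithLp 2 (L2 l × L2 l)).fst := by
  obtain ⟨c, hc⟩ := IsWeakDeriv.exists_ae_eq_primitive hl (integrable_L2 _) (integrable_L2 _) p.2
  exact ⟨_, continuousOn_const.add (continuousOn_primitive hl.le (integrable_L2 _)), hc.symm⟩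

lemma continuousRep_boundary (hl : 0 < l) (p : H1 l) {F : ℝ → ℝ} (hF : ContinuousOn F (Icc 0 l))
    (hFp : F =ᵐ[vol 0 l] (p : WithLp 2 (L2 l × L2 l)).fst) :
    F 0 = traceZero p ∧ F l = traceEnd p := by
  set f := (p : WithLp 2 (L2 l × L2 l)).fst
  set g := (p : WithLp 2 (L2 l × L2 l)).snd
  have hg : Integrable g (vol 0 l) := integrable_L2 g
  obtain ⟨c, hc⟩ := IsWeakDeriv.exists_ae_eq_primitive hl (integrable_L2 f) hg p.2
  have hFc : EqOn F (fun x => c + ∫ s in 0..x, g s) (Icc 0 l) := by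
    refine Measure.eqOn_Icc_of_ae_eq volume hl.ne ?_ hF
      (continuousOn_const.add (continuousOn_primitive hl.le hg))
    rw [← Measure.restrict_congr_set (Ioo_ae_eq_Icc (μ := volume) (a := (0 : ℝ)) (b := l))]
    exact hFp.trans hc
  have h1 : Integrable (fun _ : ℝ => (1 : ℝ)) (vol 0 l) := integrable_const _
  have e : ∫ x, 1 * f x ∂(vol 0 l) = ∫ x, 1 * (c + ∫ s in 0..x, g s) ∂(vol 0 l) :=
    integral_congr_ae (hc.mono fun x hx => congrArg (1 * ·) hx)
  have k0 := integral_bilin_primitive hl.le (ContinuousLinearMap.mul ℝ ℝ) (-l) c h1 hg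
  have kl := integral_bilin_primitive hl.le (ContinuousLinearMap.mul ℝ ℝ) 0 c h1 hg
  simp only [ContinuousLinearMap.mul_apply', intervalIntegral.integral_const, sub_zero,
    smul_eq_mul, mul_one, zero_add, zero_mul, ← e, neg_add_cancel, zero_sub, neg_mul,
    neg_neg] at k0 kl
  constructor
  · rw [hFc (left_mem_Icc.2 hl.le), traceZero, k0]
    field_simp
    simp
  · rw [hFc (right_mem_Icc.2 hl.le), traceEnd, kl]
    field_simp

/-- A test function as an element of `H¹(0, l)`. -/
def testH1 (hl : 0 < l) (ψ : 𝓓(interval 0 l, ℝ)) : H1 l :=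
  ⟨WithLp.toLp 2 ((memLp_of_continuous ψ.continuous).toLp ψ,
    (memLp_of_continuous (continuous_deriv_testFunction ψ)).toLp (deriv ψ)), by
    refine ((IsWeakDeriv.primitive hl.le 0
      (integrable_vol_of_continuous (continuous_deriv_testFunction ψ))).congr ?_
      (memLp_of_continuous (continuous_deriv_testFunction ψ)).coeFn_toLp)
    refine (memLp_of_continuous ψ.continuous).coeFn_toLp.trans (Filter.Eventually.of_forall fun t => ?_)
    change ψ t = 0 + ∫ s in 0..t, deriv ψ s
    rw [integral_deriv_testFunction, zero_add]⟩

lemma coeFn_testH1 (hl : 0 < l) (ψ : 𝓓(interval 0 l, ℝ)) :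
    (testH1 hl ψ : WithLp 2 (L2 l × L2 l)).fst =ᵐ[vol 0 l] ψ :=
  (memLp_of_continuous ψ.continuous).coeFn_toLp

end Sobolev

section Graph

variable {N : ℕ} {l : Fin N → ℝ}

lemma mem_V_iff (hl : ∀ i, 0 < l i) (φ : HH1 l) :
    φ ∈ V l ↔ (∀ i j, traceZero (φ i) = traceZero (φ j)) ∧ ∀ i, traceEnd (φ i) = 0 := by
  constructor
  · rintro ⟨F, hF, h0, hE⟩
    have hb := fun i => continuousRep_boundary (hl i) (φ i) (hF i).1 (hF i).2
    exact ⟨fun i j => by rw [← (hb i).1, ← (hb j).1, h0 i j], fun i => by rw [← (hb i).2, hE i]⟩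
  · rintro ⟨h0, hE⟩
    choose F hF hFφ using fun i => exists_continuousOn_H1 (hl i) (φ i)
    have hb := fun i => continuousRep_boundary (hl i) (φ i) (hF i) (hFφ i)
    exact ⟨F, fun i => ⟨hF i, hFφ i⟩, fun i j => by rw [(hb i).1, (hb j).1, h0 i j],
      fun i => by rw [(hb i).2, hE i]⟩

lemma isClosed_V (hl : ∀ i, 0 < l i) : IsClosed (V l : Set (HH1 l)) := by
  have : (V l : Set (HH1 l)) =
      (⋂ i, ⋂ j, {φ : HH1 l | traceZero (φ i) = traceZero (φ j)}) ∩
        ⋂ i, {φ : HH1 l | traceEnd (φ i) = 0} := by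
    ext φ
    simp only [mem_inter_iff, mem_iInter, mem_ofPred_eq]
    exact mem_V_iff hl φ
  rw [this]
  have hp : ∀ i, Continuous fun φ : HH1 l => φ i := fun i =>
    (PiLp.proj (𝕜 := ℝ) 2 (fun i => H1 (l i)) i).continuous
  exact (isClosed_iInter fun i => isClosed_iInter fun j =>
    isClosed_eq (continuous_traceZero.comp (hp i)) (continuous_traceZero.comp (hp j))).inter
    (isClosed_iInter fun i => isClosed_eq (continuous_traceEnd.comp (hp i)) continuous_const)

lemma completeSpace_V (hl : ∀ i, 0 < l i) : CompleteSpace (V l) :=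
  (isClosed_V hl).completeSpace_coe

/-- The component map `φ ↦ φᵢ` from `𝕍` to `L²(0, lᵢ)`. -/
def valL (l : Fin N → ℝ) (i : Fin N) : V l →L[ℝ] L2 (l i) :=
  WithLp.fstL 2 ℝ (L2 (l i)) (L2 (l i)) ∘L (H1 (l i)).subtypeL ∘L
    PiLp.proj 2 (fun i => H1 (l i)) i ∘L (V l).subtypeL

/-- The map `φ ↦ ∂φᵢ/∂x` from `𝕍` to `L²(0, lᵢ)`. -/
def dxL (l : Fin N → ℝ) (i : Fin N) : V l →L[ℝ] L2 (l i) :=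
  WithLp.sndL 2 ℝ (L2 (l i)) (L2 (l i)) ∘L (H1 (l i)).subtypeL ∘L
    PiLp.proj 2 (fun i => H1 (l i)) i ∘L (V l).subtypeL

lemma valL_apply (i : Fin N) (φ : V l) : valL l i φ = val (φ : HH1 l) i := rfl

lemma dxL_apply (i : Fin N) (φ : V l) : dxL l i φ = dx (φ : HH1 l) i := rfl

lemma norm_sq_component (φ : V l) (i : Fin N) :
    ‖(φ : HH1 l) i‖ ^ 2 = ‖valL l i φ‖ ^ 2 + ‖dxL l i φ‖ ^ 2 :=
  WithLp.prod_norm_sq_eq_of_L2 ((φ : HH1 l) i : WithLp 2 (L2 (l i) × L2 (l i)))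

lemma norm_sq_V (φ : V l) : ‖φ‖ ^ 2 = ∑ i, (‖valL l i φ‖ ^ 2 + ‖dxL l i φ‖ ^ 2) := by
  have : ‖φ‖ ^ 2 = ∑ i, ‖(φ : HH1 l) i‖ ^ 2 := PiLp.norm_sq_eq_of_L2 _ (φ : HH1 l)
  rw [this]
  exact Finset.sum_congr rfl fun i _ => norm_sq_component φ i

lemma norm_sq_toLL2 (φ : V l) : ‖toLL2 l φ‖ ^ 2 = ∑ i, ‖valL l i φ‖ ^ 2 :=
  PiLp.norm_sq_eq_of_L2 _ (toLL2 l φ)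

lemma toLL2_injective : Function.Injective (toLL2 l) := by
  rw [injective_iff_map_eq_zero]
  intro φ hφ
  have hv : ∀ i, val (φ : HH1 l) i = 0 := fun i => congrArg (fun x : LL2 l => x i) hφ
  have hd : ∀ i, dx (φ : HH1 l) i = 0 := by
    intro i
    have h1 : IsWeakDeriv 0 (l i) (val (φ : HH1 l) i) (dx (φ : HH1 l) i) := ((φ : HH1 l) i).2
    have h2 : IsWeakDeriv 0 (l i) (val (φ : HH1 l) i) (0 : ℝ → ℝ) := by
      refine IsWeakDeriv.zero.congr ?_ Filter.EventuallyEq.rfl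
      rw [hv i]
      exact Lp.coeFn_zero ℝ 2 (vol 0 (l i))
    refine Lp.ext ((h1.unique h2 (integrable_L2 _) (integrable_zero _ _ _)).trans ?_)
    exact (Lp.coeFn_zero ℝ 2 (vol 0 (l i))).symm
  have hn : ‖φ‖ ^ 2 = 0 := by
    rw [norm_sq_V]
    refine Finset.sum_eq_zero fun i _ => ?_
    rw [valL_apply, dxL_apply, hv i, hd i]
    simp
  exact norm_eq_zero.1 (pow_eq_zero_iff two_ne_zero |>.1 hn)

/-- The range of `𝕍 → 𝕃²` is dense: it contains the test functions on each edge. -/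
lemma eq_zero_of_inner_toLL2 (hl : ∀ i, 0 < l i) (h : LL2 l)
    (hh : ∀ φ : V l, inner ℝ h (toLL2 l φ) = 0) : h = 0 := by
  have key : ∀ i, h i = 0 := by
    intro i
    refine Lp.ext ((ae_eq_zero_of_integral_testFunction (integrable_L2 (h i)) fun ψ => ?_).trans
      (Lp.coeFn_zero ℝ 2 (vol 0 (l i))).symm)
    let φ : HH1 l := WithLp.toLp 2 (Pi.single i (testH1 (hl i) ψ))
    have hφi : φ i = testH1 (hl i) ψ := Pi.single_eq_same _ _
    have hφk : ∀ k, k ≠ i → φ k = 0 := fun k hk => Pi.single_eq_of_ne hk _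
    have hφ : φ ∈ V l := by
      refine ⟨fun k x => if k = i then ψ x else 0, fun k => ?_, fun k m => ?_, fun k => ?_⟩
      · by_cases hk : k = i
        · subst hk
          simp only [if_true]
          refine ⟨ψ.continuous.continuousOn, ?_⟩
          rw [val, hφi]
          exact (coeFn_testH1 (hl k) ψ).symm
        · simp only [if_neg hk]
          refine ⟨continuousOn_const, ?_⟩
          rw [val, hφk k hk]
          exact (Lp.coeFn_zero ℝ 2 (vol 0 (l k))).symm
      · simp only [testFunction_eq_zero ψ (t := 0) (by simp), ite_self]
      · by_cases hk : k = i
        · subst hk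
          simp only [if_true]
          exact testFunction_eq_zero ψ (by simp)
        · simp only [if_neg hk]
    have h1 := hh ⟨φ, hφ⟩
    rw [PiLp.inner_apply, Finset.sum_eq_single i, toLL2_apply] at h1
    · simp only [val, hφi] at h1
      rw [L2.inner_def] at h1
      refine (integral_congr_ae ?_).trans h1
      filter_upwards [coeFn_testH1 (hl i) ψ] with x hx
      rw [hx, inner_eq_mul, smul_eq_mul, mul_comm]
    · intro k _ hk
      rw [toLL2_apply]
      simp only [val, hφk k hk]
      exact inner_zero_right _
    · exact fun hi => absurd (Finset.mem_univ i) hi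
  ext1 i
  exact key i

end Graph

/-! ### The form `ℱ[u]` as a family of operators on `𝕍` -/

section Multiplication

variable {l : ℝ}

/-- Multiplication by a bounded measurable function on `L²(0, l)`. -/
def mulL (l : ℝ) (k : ℝ → ℝ) (hk : StronglyMeasurable k) {M : ℝ} (hM : ∀ x, |k x| ≤ M) :
    L2 l →L[ℝ] L2 l :=
  pointwise (fun x => k x • ContinuousLinearMap.id ℝ ℝ) (Λ := M)
    (fun v => (hk.smul_const v).aestronglyMeasurable) fun x => by
      rw [norm_smul, ContinuousLinearMap.norm_id, mul_one]
      exact hM x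

lemma coeFn_mulL {k : ℝ → ℝ} (hk : StronglyMeasurable k) {M : ℝ} (hM : ∀ x, |k x| ≤ M)
    (f : L2 l) : mulL l k hk hM f =ᵐ[vol 0 l] fun x => k x * f x :=
  coeFn_pointwise _ _ _ f

lemma norm_mulL_apply_le {k : ℝ → ℝ} (hk : StronglyMeasurable k) {M : ℝ} (hM : ∀ x, |k x| ≤ M)
    (f : L2 l) : ‖mulL l k hk hM f‖ ≤ M * ‖f‖ :=
  norm_pointwise_apply_le _ _ _ f

/-- A map into a second countable metric space is measurable if its distances to all points are. -/
lemma measurable_of_measurable_dist {Ω X : Type*} [MeasurableSpace Ω] [PseudoMetricSpace X]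
    [SecondCountableTopology X] [MeasurableSpace X] [BorelSpace X] {G : Ω → X}
    (h : ∀ c, Measurable fun t => dist (G t) c) : Measurable G := by
  refine measurable_of_isOpen fun s hs => ?_
  obtain ⟨S, hS, hSs⟩ := TopologicalSpace.isOpen_iUnion_countable
    (fun p : {p : X × ℝ // Metric.ball p.1 p.2 ⊆ s} => Metric.ball p.1.1 p.1.2)
    fun _ => Metric.isOpen_ball
  have hs' : s = ⋃ p ∈ S, Metric.ball p.1.1 p.1.2 := by
    rw [hSs]
    refine Subset.antisymm (fun x hx => ?_) (iUnion_subset fun p => p.2)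
    obtain ⟨ε, hε, hb⟩ := Metric.isOpen_iff.1 hs x hx
    exact mem_iUnion.2 ⟨⟨(x, ε), hb⟩, Metric.mem_ball_self hε⟩
  rw [hs', preimage_iUnion₂]
  exact MeasurableSet.biUnion hS fun p _ => (h p.1.1) measurableSet_Iio

/-- The sections of a jointly measurable function form a strongly measurable family in `L²`. -/
lemma stronglyMeasurable_of_sections {G : ℝ → L2 l} {K : ℝ → ℝ → ℝ}
    (hK : StronglyMeasurable (Function.uncurry K)) (h : ∀ t, G t =ᵐ[vol 0 l] K t) :
    StronglyMeasurable G := by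
  have : Fact ((2 : ℝ≥0∞) ≠ ∞) := ⟨by simp⟩
  have : SecondCountableTopology (L2 l) := Lp.SecondCountableTopology
  borelize (L2 l)
  refine (measurable_of_measurable_dist fun c => ?_).stronglyMeasurable
  have hc : StronglyMeasurable c := Lp.stronglyMeasurable c
  have e : ∀ t, dist (G t) c = Real.sqrt (∫ x, (K t x - c x) ^ 2 ∂(vol 0 l)) := by
    intro t
    rw [dist_eq_norm, ← Real.sqrt_sq (norm_nonneg _), norm_sq_L2T]
    congr 1
    refine integral_congr_ae ?_
    filter_upwards [Lp.coeFn_sub (G t) c, h t] with x h1 h2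
    rw [h1, Pi.sub_apply, h2, Real.norm_eq_abs, sq_abs]
  simp_rw [e]
  refine Real.continuous_sqrt.measurable.comp ?_
  refine (StronglyMeasurable.integral_prod_right (f := fun t x => (K t x - c x) ^ 2) ?_).measurable
  exact (hK.sub (hc.comp_measurable measurable_snd)).pow 2

end Multiplication

section Control

variable {N : ℕ} {l : Fin N → ℝ} {T : ℝ}

/-- The control `uᵢ`, cut off at `±‖u‖`. This changes `uᵢ` on a null set only and makes it bounded
everywhere. -/
def clip (u : LLinf l T) (i : Fin N) (t x : ℝ) : ℝ := max (-‖u‖) (min ‖u‖ (u i (x, t)))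

lemma abs_clip_le (u : LLinf l T) (i : Fin N) (t x : ℝ) : |clip u i t x| ≤ ‖u‖ :=
  abs_le.2 ⟨le_max_left _ _, max_le (neg_le_self (norm_nonneg u)) (min_le_left _ _)⟩

lemma stronglyMeasurable_clip (u : LLinf l T) (i : Fin N) :
    StronglyMeasurable (Function.uncurry (clip u i)) := by
  have h1 : StronglyMeasurable fun p : ℝ × ℝ => u i (p.2, p.1) :=
    (Lp.stronglyMeasurable (u i)).comp_measurable measurable_swap
  have hc : Continuous fun y : ℝ => max (-‖u‖) (min ‖u‖ y) := by fun_prop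
  exact hc.comp_stronglyMeasurable h1

lemma stronglyMeasurable_clip_section (u : LLinf l T) (i : Fin N) (t : ℝ) :
    StronglyMeasurable (clip u i t) :=
  (stronglyMeasurable_clip u i).comp_measurable measurable_prodMk_left

lemma ae_abs_le_norm (u : LLinf l T) (i : Fin N) :
    ∀ᵐ z ∂((volume : Measure (ℝ × ℝ)).restrict (Ioo 0 (l i) ×ˢ Ioo 0 T)), |u i z| ≤ ‖u‖ := by
  have h1 : ‖u i‖ ≤ ‖u‖ := PiLp.norm_apply_le u i
  filter_upwards [ae_le_eLpNormEssSup (f := u i)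
    (μ := (volume : Measure (ℝ × ℝ)).restrict (Ioo 0 (l i) ×ˢ Ioo 0 T))] with z hz
  refine le_trans ?_ h1
  rw [Lp.norm_def, eLpNorm_exponent_top]
  have h2 := Lp.eLpNorm_lt_top (u i)
  rw [eLpNorm_exponent_top] at h2
  have h3 := ENNReal.toReal_mono h2.ne hz
  rwa [toReal_enorm] at h3

lemma ae_clip_eq (u : LLinf l T) (i : Fin N) :
    ∀ᵐ t ∂(vol 0 T), ∀ᵐ x ∂(vol 0 (l i)), clip u i t x = u i (x, t) := by
  have h1 : ∀ᵐ z ∂((vol 0 (l i)).prod (vol 0 T)), clip u i z.2 z.1 = u i z := by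
    rw [Measure.prod_restrict]
    filter_upwards [ae_abs_le_norm u i] with z hz
    rw [abs_le] at hz
    rw [clip, min_eq_right hz.2, max_eq_right hz.1]
  have hm : MeasurableSet {z : ℝ × ℝ | clip u i z.2 z.1 = u i (z.1, z.2)} :=
    measurableSet_eq_fun
      ((stronglyMeasurable_clip u i).comp_measurable measurable_swap).measurable
      (Lp.stronglyMeasurable (u i)).measurable
  exact (Measure.ae_ae_comm hm).1 (Measure.ae_ae_of_ae_prod h1)

/-- Multiplication by the cut off control at the time `t`. -/
def controlL (u : LLinf l T) (i : Fin N) (t : ℝ) : L2 (l i) →L[ℝ] L2 (l i) :=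
  mulL (l i) (clip u i t) (stronglyMeasurable_clip_section u i t) (abs_clip_le u i t)

lemma stronglyMeasurable_controlL (u : LLinf l T) (i : Fin N) (f : L2 (l i)) :
    StronglyMeasurable fun t => controlL u i t f := by
  refine stronglyMeasurable_of_sections (K := fun t x => clip u i t x * f x) ?_ fun t =>
    coeFn_mulL _ _ f
  exact (stronglyMeasurable_clip u i).mul
    ((Lp.stronglyMeasurable f).comp_measurable measurable_snd)

lemma norm_controlL_le (u : LLinf l T) (i : Fin N) (t : ℝ) (f : L2 (l i)) :
    ‖controlL u i t f‖ ≤ ‖u‖ * ‖f‖ :=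
  norm_mulL_apply_le _ _ f

variable [CompleteSpace (V l)]

/-- The operator on `𝕍` that represents the form `ℱ[u]` at the time `t`. -/
def formOp (D : Fin N → ℝ) (u : LLinf l T) (t : ℝ) : V l →L[ℝ] V l :=
  ∑ i, ContinuousLinearMap.adjoint (dxL l i) ∘L (D i • dxL l i + controlL u i t ∘L valL l i)

lemma inner_formOp (D : Fin N → ℝ) (u : LLinf l T) (t : ℝ) (ρ φ : V l) :
    inner ℝ (formOp D u t ρ) φ =
      ∑ i, inner ℝ (D i • dxL l i ρ + controlL u i t (valL l i ρ)) (dxL l i φ) := by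
  rw [formOp, sum_apply, sum_inner]
  refine Finset.sum_congr rfl fun i _ => ?_
  rw [ContinuousLinearMap.comp_apply, ContinuousLinearMap.adjoint_inner_left]
  rfl

lemma stronglyMeasurable_formOp (D : Fin N → ℝ) (u : LLinf l T) (ρ : V l) :
    StronglyMeasurable fun t => formOp D u t ρ := by
  have : (fun t => formOp D u t ρ) = fun t => ∑ i, ContinuousLinearMap.adjoint (dxL l i)
      (D i • dxL l i ρ + controlL u i t (valL l i ρ)) := by
    funext t
    rw [formOp, sum_apply]
    rfl
  rw [this]
  exact Finset.stronglyMeasurable_fun_sum _ fun i _ =>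
    (ContinuousLinearMap.continuous _).comp_stronglyMeasurable
      (stronglyMeasurable_const.add (stronglyMeasurable_controlL u i _))

lemma form_eq_inner_formOp (D : Fin N → ℝ) (u : LLinf l T) :
    ∀ᵐ t ∂(vol 0 T), ∀ ρ φ : V l, form D u t ρ φ = inner ℝ (formOp D u t ρ) φ := by
  filter_upwards [ae_all_iff.2 fun i => ae_clip_eq u i] with t ht ρ φ
  rw [inner_formOp, form]
  refine Finset.sum_congr rfl fun i _ => ?_
  rw [L2.inner_def]
  refine integral_congr_ae ?_
  filter_upwards [ht i, Lp.coeFn_add (D i • dxL l i ρ) (controlL u i t (valL l i ρ)),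
    Lp.coeFn_smul (D i) (dxL l i ρ), coeFn_mulL (stronglyMeasurable_clip_section u i t)
      (abs_clip_le u i t) (valL l i ρ)] with x h1 h2 h3 h4
  have h5 : controlL u i t (valL l i ρ) x = clip u i t x * valL l i ρ x := h4
  rw [h2, Pi.add_apply, h3, Pi.smul_apply, h5, h1, inner_eq_mul, smul_eq_mul]
  rfl

lemma formOp_coercive {D : Fin N → ℝ} {d : ℝ} (hd : 0 < d) (hD : ∀ i, d ≤ D i) (u : LLinf l T)
    (t : ℝ) (ρ : V l) : d / 2 * ‖ρ‖ ^ 2 ≤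
      inner ℝ (formOp D u t ρ) ρ + (d / 2 + ‖u‖ ^ 2 / (2 * d)) * ‖toLL2 l ρ‖ ^ 2 := by
  rw [inner_formOp, norm_sq_V, norm_sq_toLL2, Finset.mul_sum, Finset.mul_sum,
    ← Finset.sum_add_distrib]
  refine Finset.sum_le_sum fun i _ => ?_
  rw [inner_add_left, inner_smul_left, real_inner_self_eq_norm_sq, conj_trivial]
  set a := ‖dxL l i ρ‖ with ha
  set b := ‖valL l i ρ‖ with hb
  have h1 : -(‖u‖ * b * a) ≤ inner ℝ (controlL u i t (valL l i ρ)) (dxL l i ρ) := by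
    have h2 := abs_real_inner_le_norm (controlL u i t (valL l i ρ)) (dxL l i ρ)
    have h3 := mul_le_mul_of_nonneg_right (norm_controlL_le u i t (valL l i ρ)) (norm_nonneg
      (dxL l i ρ))
    exact (abs_le.1 (h2.trans h3)).1
  have h4 : d * a ^ 2 ≤ D i * a ^ 2 := mul_le_mul_of_nonneg_right (hD i) (sq_nonneg a)
  -- Young's inequality, as the square of `d a - ‖u‖ b`
  have h5 : ‖u‖ * b * a ≤ d / 2 * a ^ 2 + ‖u‖ ^ 2 / (2 * d) * b ^ 2 := by
    have h6 : d / 2 * a ^ 2 + ‖u‖ ^ 2 / (2 * d) * b ^ 2 - ‖u‖ * b * a =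
        (d * a - ‖u‖ * b) ^ 2 / (2 * d) := by
      field_simp
      ring
    have h7 : 0 ≤ (d * a - ‖u‖ * b) ^ 2 / (2 * d) := by positivity
    linarith
  linarith

lemma norm_formOp_le {D : Fin N → ℝ} {d : ℝ} (hd : 0 ≤ d) (hD : ∀ i, |D i| ≤ d)
    (u : LLinf l T) (t : ℝ) : ‖formOp D u t‖ ≤ d + ‖u‖ := by
  refine ContinuousLinearMap.opNorm_le_bound _ (by positivity) fun ρ => ?_
  have key : ∀ φ : V l, inner ℝ (formOp D u t ρ) φ ≤ (d + ‖u‖) * (‖ρ‖ * ‖φ‖) := by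
    intro φ
    rw [inner_formOp]
    have hcomp : ∀ (χ : V l) (i : Fin N), ‖dxL l i χ‖ ≤ ‖(χ : HH1 l) i‖ ∧
        ‖valL l i χ‖ ≤ ‖(χ : HH1 l) i‖ := by
      intro χ i
      have h := norm_sq_component χ i
      exact ⟨abs_le_of_sq_le_sq' (by nlinarith [sq_nonneg ‖valL l i χ‖]) (norm_nonneg _) |>.2,
        abs_le_of_sq_le_sq' (by nlinarith [sq_nonneg ‖dxL l i χ‖]) (norm_nonneg _) |>.2⟩
    have h1 : ∀ i, inner ℝ (D i • dxL l i ρ + controlL u i t (valL l i ρ)) (dxL l i φ) ≤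
        (d + ‖u‖) * (‖(ρ : HH1 l) i‖ * ‖(φ : HH1 l) i‖) := by
      intro i
      have h2 : ‖D i • dxL l i ρ + controlL u i t (valL l i ρ)‖ ≤
          (d + ‖u‖) * ‖(ρ : HH1 l) i‖ := by
        refine (norm_add_le _ _).trans ?_
        rw [norm_smul, add_mul]
        exact add_le_add (mul_le_mul (hD i) (hcomp ρ i).1 (norm_nonneg _) hd)
          ((norm_controlL_le u i t _).trans
            (mul_le_mul_of_nonneg_left (hcomp ρ i).2 (norm_nonneg _)))
      calc _ ≤ ‖D i • dxL l i ρ + controlL u i t (valL l i ρ)‖ * ‖dxL l i φ‖ :=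
            real_inner_le_norm _ _
        _ ≤ (d + ‖u‖) * ‖(ρ : HH1 l) i‖ * ‖(φ : HH1 l) i‖ :=
            mul_le_mul h2 (hcomp φ i).1 (norm_nonneg _) (by positivity)
        _ = _ := by ring
    have h3 : ∀ χ : V l, Real.sqrt (∑ i, ‖(χ : HH1 l) i‖ ^ 2) = ‖χ‖ := fun χ => by
      have h4 : ‖χ‖ ^ 2 = ∑ i, ‖(χ : HH1 l) i‖ ^ 2 := PiLp.norm_sq_eq_of_L2 _ (χ : HH1 l)
      rw [← h4, Real.sqrt_sq (norm_nonneg _)]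
    refine (Finset.sum_le_sum fun i _ => h1 i).trans ?_
    rw [← Finset.mul_sum, ← h3 ρ, ← h3 φ]
    exact mul_le_mul_of_nonneg_left (Real.sum_mul_le_sqrt_mul_sqrt _ _ _) (by positivity)
  have h5 := key (formOp D u t ρ)
  rw [real_inner_self_eq_norm_sq] at h5
  rcases (norm_nonneg (formOp D u t ρ)).eq_or_lt with h6 | h6
  · rw [← h6]
    positivity
  · refine le_of_mul_le_mul_right ?_ h6
    linarith

/-- The weak formulation in terms of `form` and in terms of the operators `formOp`. -/
lemma isWeakSolution_iff (hT : 0 ≤ T) (D : Fin N → ℝ) (u : LLinf l T) (ρ0 : LL2 l) (ρ : W l T) :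
    IsWeakSolution hT D u ρ0 ρ ↔ SolvesEvolution hT (toLL2 l) (formOp D u) ρ0 ρ := by
  have e : ∀ (φ : V l) (ψ : 𝓓(interval 0 T, ℝ)),
      ∫ t, ψ t * form D u t (EvolutionSpace.toL2T ρ t) φ ∂(vol 0 T) =
        ∫ t, ψ t * inner ℝ (formOp D u t (EvolutionSpace.toL2T ρ t)) φ ∂(vol 0 T) := by
    intro φ ψ
    refine integral_congr_ae ?_
    filter_upwards [form_eq_inner_formOp D u] with t ht
    rw [ht]
  simp only [IsWeakSolution, SolvesEvolution, e]

end Control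

/-! ### Well-posedness with explicit constants -/

section Bounds

variable {N : ℕ} {l : Fin N → ℝ} {T : ℝ}

/-- The multiple `λ` of the `𝕃²`-norm up to which `ℱ[u]` is coercive, for `‖u‖ = M` and diffusion
coefficients at least `d`. -/
def shift (d M : ℝ) : ℝ := d / 2 + M ^ 2 / (2 * d)

/-- The bound for the solution operator `𝕃² → L²(0, T; 𝕍)`. -/
def energyBound (T d M : ℝ) : ℝ :=
  Real.sqrt ((1 + 2 * shift d M * T * Real.exp (2 * shift d M * T)) / (2 * (d / 2)))

/-- The constant of the a priori estimates. The summands bound the solution in `C([0, T]; 𝕃²)` and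
in `𝕎(0, T)`; the factor `1 + (dmax + M)` comes from `‖ρ_t‖ ≤ (dmax + M) ‖ρ‖`. -/
def solutionBound (T dmin dmax M : ℝ) : ℝ :=
  Real.exp (shift dmin M * T) + (1 + (dmax + M)) * energyBound T dmin M

lemma continuous_solutionBound (T dmin dmax : ℝ) : Continuous (solutionBound T dmin dmax) := by
  unfold solutionBound energyBound shift
  fun_prop

lemma solutionBound_pos {T dmin dmax M : ℝ} (hdmax : 0 ≤ dmax) (hM : 0 ≤ M) :
    0 < solutionBound T dmin dmax M :=
  add_pos_of_pos_of_nonneg (Real.exp_pos _)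
    (mul_nonneg (by positivity) (Real.sqrt_nonneg _))

lemma solutionBound_estimates {dmin dmax M x y z x0 : ℝ} (hdmax : 0 ≤ dmax) (hM : 0 ≤ M)
    (hx0 : 0 ≤ x0) (hx : x ≤ Real.exp (shift dmin M * T) * x0) (hy : y ≤ energyBound T dmin M * x0)
    (hz : z ≤ (1 + (dmax + M)) * y) :
    x + y ≤ solutionBound T dmin dmax M * x0 ∧ z ≤ solutionBound T dmin dmax M * x0 := by
  have h1 : energyBound T dmin M * x0 ≤ (1 + (dmax + M)) * energyBound T dmin M * x0 :=
    mul_le_mul_of_nonneg_right (le_mul_of_one_le_left (Real.sqrt_nonneg _) (by linarith)) hx0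
  have h2 : (1 + (dmax + M)) * y ≤ (1 + (dmax + M)) * (energyBound T dmin M * x0) :=
    mul_le_mul_of_nonneg_left hy (by positivity)
  have h3 := mul_nonneg (Real.exp_pos (shift dmin M * T)).le hx0
  rw [solutionBound, add_mul]
  exact ⟨by linarith, by linarith⟩

set_option maxHeartbeats 800000 in
/-- Well-posedness of the Fokker–Planck system with bounds `dmin ≤ Dᵢ ≤ dmax` on the diffusion
coefficients. -/
theorem existsUnique_isWeakSolution (hl : ∀ i, 0 < l i) {D : Fin N → ℝ} {dmin dmax : ℝ}
    (hdmin : 0 < dmin) (hdmax : 0 ≤ dmax) (hmin : ∀ i, dmin ≤ D i) (hmax : ∀ i, D i ≤ dmax)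
    (hT : 0 < T) (u : LLinf l T) (ρ0 : LL2 l) :
    ∃ ρ : W l T, IsWeakSolution hT.le D u ρ0 ρ ∧
      (∀ ρ' : W l T, IsWeakSolution hT.le D u ρ0 ρ' → ρ' = ρ) ∧
      ∃ r : C(Icc (0 : ℝ) T, LL2 l), IsTimeContRep ρ r ∧
        ‖r‖ + ‖EvolutionSpace.toL2T ρ‖ ≤ solutionBound T dmin dmax ‖u‖ * ‖ρ0‖ ∧
        ‖ρ‖ ≤ solutionBound T dmin dmax ‖u‖ * ‖ρ0‖ := by
  have : CompleteSpace (V l) := completeSpace_V hl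
  have hM : 0 ≤ ‖u‖ := norm_nonneg u
  have hshift : 0 ≤ shift dmin ‖u‖ := by
    unfold shift
    positivity
  have habs : ∀ i, |D i| ≤ dmax := fun i =>
    (abs_of_pos (hdmin.trans_le (hmin i))).trans_le (hmax i)
  obtain ⟨ρ, hρ, huniq, r, hr, hrn, hwn, hWn⟩ :=
    existsUnique_solvesEvolution (V := V l) (H := LL2 l) (j := toLL2 l)
      (A := formOp D u) (Λ := dmax + ‖u‖) (α := dmin / 2) (lam := shift dmin ‖u‖) hT
      toLL2_injective (eq_zero_of_inner_toLL2 hl) (half_pos hdmin) hshift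
      (fun v => (stronglyMeasurable_formOp D u v).aestronglyMeasurable)
      (norm_formOp_le hdmax habs u) (formOp_coercive hdmin hmin u) ρ0
  exact ⟨ρ, (isWeakSolution_iff hT.le D u ρ0 ρ).2 hρ,
    fun ρ' h => huniq ρ' ((isWeakSolution_iff hT.le D u ρ0 ρ').1 h), r, hr,
    solutionBound_estimates hdmax hM (norm_nonneg ρ0) hrn hwn hWn⟩

end Bounds

end StarGraph

end

theorem theorem3p2 :
    ∃ C : ℝ → ℝ → ℝ → ℝ → ℝ,
      (∀ T dmin dmax : ℝ, 0 < T → 0 < dmin → dmin ≤ dmax →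
        ContinuousOn (C T dmin dmax) (Set.Ici 0) ∧ ∀ M : ℝ, 0 ≤ M → 0 < C T dmin dmax M) ∧
      ∀ (N : ℕ) [NeZero N] (l D : Fin N → ℝ) (T : ℝ) (_ : ∀ i, 0 < l i) (_ : ∀ i, 0 < D i)
        (hT : 0 < T) (u : StarGraph.LLinf l T) (ρ0 : StarGraph.LL2 l),
        ∃ ρ : StarGraph.W l T,
          StarGraph.IsWeakSolution hT.le D u ρ0 ρ ∧
          (∀ ρ' : StarGraph.W l T, StarGraph.IsWeakSolution hT.le D u ρ0 ρ' → ρ' = ρ) ∧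
          ∃ r : C(Set.Icc (0 : ℝ) T, StarGraph.LL2 l),
            StarGraph.IsTimeContRep ρ r ∧
            ‖r‖ + ‖StarGraph.EvolutionSpace.toL2T ρ‖ ≤
              C T (Finset.univ.inf' Finset.univ_nonempty D)
                (Finset.univ.sup' Finset.univ_nonempty D) ‖u‖ * ‖ρ0‖ ∧
            ‖ρ‖ ≤
              C T (Finset.univ.inf' Finset.univ_nonempty D)
                (Finset.univ.sup' Finset.univ_nonempty D) ‖u‖ * ‖ρ0‖ := by
  refine ⟨StarGraph.solutionBound, fun T dmin dmax _ hdmin hle =>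
    ⟨(StarGraph.continuous_solutionBound T dmin dmax).continuousOn, fun M hM =>
      StarGraph.solutionBound_pos (hdmin.le.trans hle) hM⟩, ?_⟩
  intro N _ l D T hl hD hT u ρ0
  have hmax : ∀ i, D i ≤ Finset.univ.sup' Finset.univ_nonempty D := fun i =>
    Finset.le_sup' D (Finset.mem_univ i)
  exact StarGraph.existsUnique_isWeakSolution hl
    ((Finset.lt_inf'_iff _).2 fun i _ => hD i) ((hD 0).le.trans (hmax 0))
    (fun i => Finset.inf'_le D (Finset.mem_univ i)) hmax hT u ρ0
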